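/- **Setting.** Let $n\ge 1$, let $\mathbb F$ be a field and let $V=\bigoplus_{i\in\mathbb Z/n}V_i$ be a finite-dimensional $\mathbb F$-vector space with a fixed decomposition (some $V_i$ may be $0$). Put $\widetilde V=\bigcup_i V_i$, $K=\prod_i GL(V_i)\subset GL(V)$, let $\mathcal N$ be the set of nilpotent $x\in\operatorname{End}(V)$ with $xV_i\subset V_{i+1}$ for all $i\in\mathbb Z/n$, and let $\xi(V)\colon m\mapsto\dim V_m$. The group $K$ acts on $V\times\mathcal N$ by $g\cdot(v,x)=(gv,gxg^{-1})$, preserving $\widetilde V\times\mathcal N$; write $\mathcal O_{v,x}$ for the orbit of $(v,x)$, and regard $K\backslash(\widetilde V\times\mathcal N)$ as a subset of $K\backslash(V\times\mathcal N)$. A *colored partition* $(\lambda,\epsilon)$ consists of a weakly decreasing $\lambda\colon\mathbb Z_{>0}\to\mathbb Z_{\ge0}$ that takes the value $0$, and $\epsilon\colon\mathbb Z_{>0}\to\mathbb Z/n$ taking every value infinitely often; $l(\lambda)=\#\{i:\lambda_i>0\}$. Its *signature* is $m\mapsto\#\{(i,j): 1\le j\le\lambda_i,\ \epsilon_i+[\lambda_i-j]=m\}$.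 A *marked colored partition* $(\lambda,\epsilon,\mu)$ has in addition $\mu\colon\mathbb Z_{>0}\to\mathbb Z$ with $\mu_i\le\lambda_i$ for all $i$; put $\nu=\lambda-\mu$. It is a *generalized colored quasi-bipartition* if $\mu_i>-n$ for all $i$, and $\mu_j<\mu_i+n$ and $\nu_j<\nu_i+n$ for all $i<j$ with $\epsilon_i+[\nu_i]=\epsilon_j+[\nu_j]$. It is a *colored quasi-bipartition* if $\mu_i>-n$ for all $i$, $\mu_j<\mu_i+n$ and $\nu_j<\nu_i+n$ for all $i<j$, and $\epsilon_i+[\nu_i]=\epsilon_j+[\nu_j]$ for all $i,j$. For $m\in\mathbb Z/n$ put $\rho_m(\lambda,\epsilon,\mu)=(\lambda,\epsilon,\delta)$ with $\delta_i=\max\{k\in\mathbb Z: k\le\mu_i,\ \epsilon_i+[\lambda_i-k]=m\}$. Two marked colored partitions $(\lambda,\epsilon,\mu)$, $(\alpha,\beta,\gamma)$ are *row equivalent* if $(\alpha,\beta,\gamma)=(\lambda\circ\sigma,\epsilon\circ\sigma,\mu\circ\sigma)$ for a permutation $\sigma$ of $\mathbb Z_{>0}$. They are *equivalent* if for some $\sigma$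 one has $\alpha=\lambda\circ\sigma$, $\beta=\epsilon\circ\sigma$, and $\gamma_i=\mu_{\sigma(i)}$ whenever $\gamma_i>0$ or $\mu_{\sigma(i)}>0$. Let $\widetilde{\mathcal P}_f$ be the set of equivalence classes of marked colored partitions of signature $f$, and $\widetilde{\mathcal Q}_f\subset\widetilde{\mathcal P}_f$ the set of those classes that contain a colored quasi-bipartition. A *colored Jordan basis of type $(\lambda,\epsilon)$* for $x\in\mathcal N$ is a basis $\{v_{i,j}: 1\le i\le l(\lambda),\ 1\le j\le\lambda_i\}$ of $V$ with $v_{i,j}\in V_{\epsilon_i+[\lambda_i-j]}$, $xv_{i,1}=0$ and $xv_{i,j}=v_{i,j-1}$ for $j>1$; we then say that $x$ has colored Jordan type $(\lambda,\epsilon)$, and put $v_{i,j}=0$ for $j\le0$. For $(\lambda,\epsilon,\mu)$ of signature $\xi(V)$ set $\Psi(\lambda,\epsilon,\mu)=\mathcal O_{v,x}$ with $v=\sum_{i=1}^{l(\lambda)}v_{i,\mu_i}$, where $x\in\mathcal N$ has a colored Jordan basis $\{v_{i,j}\}$ of type $(\lambda,\epsilon)$; this is independent of the choices and depends only on the class in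 $\widetilde{\mathcal P}_{\xi(V)}$. A *normal basis* for $(v,x)\in V\times\mathcal N$ is a colored Jordan basis $\{v_{i,j}\}$ for $x$, of type $(\lambda,\epsilon)$ say, such that $v=\sum_i v_{i,\mu_i}$ for a marking $\mu$ for which $(\lambda,\epsilon,\mu)$ is a generalized colored quasi-bipartition. **Theorem.** 1. The image of $\Psi$ in $K\backslash(V\times\mathcal N)$ is precisely the set of orbits whose elements admit a normal basis. Every nonempty fiber of $\Psi$ contains a generalized colored quasi-bipartition. 2. $\Psi$ restricts to a bijection $\widetilde{\mathcal Q}_{\xi(V)}\to K\backslash(\widetilde V\times\mathcal N)$. More precisely: - (a) an orbit $\mathcal O\in K\backslash(V\times\mathcal N)$ lies in $K\backslash(\widetilde V\times\mathcal N)$ if and only if $\mathcal O=\Psi(\lambda,\epsilon,\mu)$ for some colored quasi-bipartition $(\lambda,\epsilon,\mu)$ of signature $\xi(V)$; - (b) if $(v,x)\in\widetilde V\times\mathcal N$ and $v\ne0$, then any two colored quasi-bipartitions that $\Psi$ sends to $\mathcal O_{v,x}$ are row equivalent; - (c) if $x\in\mathcal N$, then the colored quasi-bipartitions that $\Psi$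 sends to $\mathcal O_{0,x}$ are precisely the $\rho_m(\lambda,\epsilon,0)$, where $m\in\mathbb Z/n$ and $(\lambda,\epsilon)$ is a colored Jordan type of $x$; for a fixed colored Jordan type $(\lambda,\epsilon)$ of $x$ they are, up to row equivalence, the $\rho_m(\lambda,\epsilon,0)$ with $m\in\mathbb Z/n$. -/

import Mathlib

namespace EnhancedCone

/-! ### Colored partitions and their markings

Rows are indexed from `0`, so that row `i` here is row `i + 1` in one-based notation. -/

/-- An `n`-colored partition `(λ, ε)`: `len` is `λ`, `color` is `ε`. -/
@[ext]
structure ColoredPartition (n : ℕ) where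
  len : ℕ → ℕ
  color : ℕ → ZMod n
  len_antitone : Antitone len
  exists_len_eq_zero : ∃ i, len i = 0
  infinite_color : ∀ m : ZMod n, {i | color i = m}.Infinite

/-- A marked colored partition `(λ, ε, μ)`: `mark` is `μ`. -/
@[ext]
structure MarkedColoredPartition (n : ℕ) extends ColoredPartition n where
  mark : ℕ → ℤ
  mark_le : ∀ i, mark i ≤ len i

namespace ColoredPartition

variable {n : ℕ} (c : ColoredPartition n)

/-- The number of nonzero rows. -/
noncomputable def length : ℕ := {i | 0 < c.len i}.ncard

/-- The boxes of the Young diagram: `⟨i, j⟩` is the box of row `i` and column `j`, columns being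
counted from `0` on the left. -/
abbrev Box : Type := Σ i : ℕ, Fin (c.len i)

/-- The rightmost box of row `i` has color `ε_i`, and colors increase by `1` from right to left.
(The one-based column of `p` is `p.2 + 1`.) -/
def boxColor (p : c.Box) : ZMod n :=
  c.color p.1 + ((((c.len p.1 : ℤ) - ((p.2 : ℕ) + 1 : ℤ)) : ℤ) : ZMod n)

/-- The number of boxes of each color. -/
noncomputable def signature (m : ZMod n) : ℕ := Nat.card {p : c.Box // c.boxColor p = m}

/-- The marking `μ = 0`. -/
def zeroMarking : MarkedColoredPartition n where
  toColoredPartition := c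
  mark := fun _ => 0
  mark_le := fun _ => Int.natCast_nonneg _

end ColoredPartition

namespace MarkedColoredPartition

variable {n : ℕ}

/-- `ν = λ - μ`. -/
def nu (P : MarkedColoredPartition n) (i : ℕ) : ℤ := (P.len i : ℤ) - P.mark i

/-- `ε_i + [ν_i]`. -/
def markColor (P : MarkedColoredPartition n) (i : ℕ) : ZMod n :=
  P.color i + ((P.nu i : ℤ) : ZMod n)

/-- Colored (`n`-)quasi-bipartitions. -/
def IsColoredQuasiBipartition (P : MarkedColoredPartition n) : Prop :=
  (∀ i, -(n : ℤ) < P.mark i) ∧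
  (∀ i j, i < j → P.mark j < P.mark i + n ∧ P.nu j < P.nu i + n) ∧
  (∀ i j, P.markColor i = P.markColor j)

/-- Generalized colored (`n`-)quasi-bipartitions: the inequalities are only required between
rows with `ε_i + [ν_i] = ε_j + [ν_j]`. -/
def IsGeneralizedQuasiBipartition (P : MarkedColoredPartition n) : Prop :=
  (∀ i, -(n : ℤ) < P.mark i) ∧
  (∀ i j, i < j → P.markColor i = P.markColor j →
    P.mark j < P.mark i + n ∧ P.nu j < P.nu i + n)

/-- Equality up to a permutation of the rows, along with the corresponding marks. -/
def RowEquiv (P Q : MarkedColoredPartition n) : Prop :=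
  ∃ σ : Equiv.Perm ℕ, ∀ i,
    Q.len i = P.len (σ i) ∧ Q.color i = P.color (σ i) ∧ Q.mark i = P.mark (σ i)

/-- Equality up to a permutation of the rows, where the values of nonpositive marks are
disregarded. -/
def WeakEquiv (P Q : MarkedColoredPartition n) : Prop :=
  ∃ σ : Equiv.Perm ℕ, ∀ i,
    Q.len i = P.len (σ i) ∧ Q.color i = P.color (σ i) ∧
    (0 < Q.mark i ∨ 0 < P.mark (σ i) → Q.mark i = P.mark (σ i))

theorem weakEquiv_equivalence : Equivalence (WeakEquiv (n := n)) where
  refl P := ⟨1, fun i => ⟨rfl, rfl, fun _ => rfl⟩⟩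
  symm := by
    rintro P Q ⟨σ, h⟩
    refine ⟨σ.symm, fun i => ?_⟩
    have := h (σ.symm i)
    rw [Equiv.apply_symm_apply] at this
    exact ⟨this.1.symm, this.2.1.symm, fun h' => (this.2.2 h'.symm).symm⟩
  trans := by
    rintro P Q R ⟨σ, h⟩ ⟨τ, k⟩
    refine ⟨σ * τ, fun i => ?_⟩
    obtain ⟨a, b, e⟩ := k i
    obtain ⟨a', b', e'⟩ := h (τ i)
    refine ⟨a.trans a', b.trans b', fun h' => ?_⟩
    simp only [Equiv.Perm.mul_apply] at h' ⊢
    omega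

/-- The possible values of a mark in row `i` that do not exceed `μ_i` and give color `m`. -/
def rhoCandidates (m : ZMod n) (P : MarkedColoredPartition n) (i : ℕ) : Set ℤ :=
  {k | k ≤ P.mark i ∧ P.color i + ((((P.len i : ℤ) - k : ℤ)) : ZMod n) = m}

theorem rhoCandidates_nonempty [NeZero n] (m : ZMod n) (P : MarkedColoredPartition n) (i : ℕ) :
    (rhoCandidates m P i).Nonempty := by
  refine ⟨P.mark i - ((m - P.markColor i).val : ℤ), by omega, ?_⟩
  simp only [markColor, nu]
  push_cast [ZMod.natCast_val, ZMod.cast_id]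
  ring

/-- `ρ_m(λ, ε, μ) = (λ, ε, δ)` with `δ_i = max {k ∈ ℤ | k ≤ μ_i, ε_i + [λ_i - k] = m}`. -/
noncomputable def rho [NeZero n] (m : ZMod n) (P : MarkedColoredPartition n) :
    MarkedColoredPartition n where
  toColoredPartition := P.toColoredPartition
  mark := fun i => sSup (rhoCandidates m P i)
  mark_le := fun i =>
    (csSup_le (rhoCandidates_nonempty m P i) fun _ hk => hk.1).trans (P.mark_le i)

end MarkedColoredPartition

/-- Marked colored partitions of signature `f`. -/
abbrev MarkedOfSignature {n : ℕ} (f : ZMod n → ℕ) : Type :=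
  {P : MarkedColoredPartition n // P.signature = f}

/-- The relation `WeakEquiv` on the marked colored partitions of signature `f`. -/
instance markedSetoid {n : ℕ} (f : ZMod n → ℕ) : Setoid (MarkedOfSignature f) :=
  Setoid.comap Subtype.val ⟨MarkedColoredPartition.WeakEquiv,
    MarkedColoredPartition.weakEquiv_equivalence⟩

/-- Classes of marked colored partitions of signature `f` under `WeakEquiv`. -/
abbrev MarkedClass {n : ℕ} (f : ZMod n → ℕ) : Type := Quotient (markedSetoid f)

/-- The classes that contain at least one colored quasi-bipartition. -/
def quasiBipartitionClasses {n : ℕ} (f : ZMod n → ℕ) : Set (MarkedClass f) :=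
  {q | ∃ P : MarkedOfSignature f, P.1.IsColoredQuasiBipartition ∧ ⟦P⟧ = q}

/-! ### The enhanced colored nilpotent cone -/

section Cone

variable {F : Type*} [Field F] {V : Type*} [AddCommGroup V] [Module F V] {n : ℕ}

/-- The signature `ξ(V)` of the colored vector space `V = ⨁ V_i`, where `V_i = C i`. -/
noncomputable def spaceSignature (C : ZMod n → Submodule F V) (m : ZMod n) : ℕ :=
  Module.finrank F (C m)

/-- The set of colored vectors, the union of the `V_i`. -/
def coloredVectors (C : ZMod n → Submodule F V) : Set V := ⋃ i, (C i : Set V)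

/-- The group `K` of linear automorphisms of `V` that preserve every `V_i`. -/
def colorGroup (C : ZMod n → Submodule F V) : Subgroup (V ≃ₗ[F] V) where
  carrier := {g | ∀ i v, g v ∈ C i ↔ v ∈ C i}
  one_mem' := fun _ _ => Iff.rfl
  mul_mem' := fun {a b} ha hb i v => (ha i (b v)).trans (hb i v)
  inv_mem' := fun {a} ha i v => by
    have h := ha i (a⁻¹ v)
    rw [show a (a⁻¹ v) = v from a.apply_symm_apply v] at h
    exact h.symm

/-- The colored nilpotent cone: nilpotent `x ∈ End(V)` with `x V_i ⊆ V_{i+1}`. -/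
def NilCone (C : ZMod n → Submodule F V) : Type _ :=
  {x : Module.End F V // IsNilpotent x ∧ ∀ i, ∀ v ∈ C i, x v ∈ C (i + 1)}

/-- `K` acts on the colored nilpotent cone by conjugation. -/
instance (C : ZMod n → Submodule F V) : MulAction (colorGroup C) (NilCone C) where
  smul g x := ⟨(g : V ≃ₗ[F] V).conj x.1,
    by
      obtain ⟨⟨k, hk⟩, -⟩ := x.2
      refine ⟨⟨k, ?_⟩, fun i v hv => ?_⟩
      · have := (map_pow ((g : V ≃ₗ[F] V).conjRingEquiv) x.1 k).symm
        rw [hk, map_zero] at this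
        exact this
      · have h1 : (g : V ≃ₗ[F] V).symm v ∈ C i := ((g⁻¹).2 i v).2 hv
        exact (g.2 _ _).2 (x.2.2 i _ h1)⟩
  one_smul x := Subtype.ext (LinearMap.ext fun _ => rfl)
  mul_smul g h x := Subtype.ext (LinearMap.ext fun _ => rfl)

/-- The set `K \ (V × 𝒩)` of orbits of the diagonal action. -/
abbrev Orbit (C : ZMod n → Submodule F V) : Type _ :=
  MulAction.orbitRel.Quotient (colorGroup C) (V × NilCone C)

/-- The orbit of `(v, x)`. -/
def orbitOf (C : ZMod n → Submodule F V) (v : V) (x : NilCone C) : Orbit C :=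
  Quotient.mk _ (v, x)

/-- The subset of `K \ (V × 𝒩)` consisting of the orbits contained in `(⋃ V_i) × 𝒩`. -/
def enhancedOrbits (C : ZMod n → Submodule F V) : Set (Orbit C) :=
  {O | ∃ v ∈ coloredVectors C, ∃ x, orbitOf C v x = O}

/-- The basis `b`, labeled by the boxes of the diagram of `c = (λ, ε)`, is a colored Jordan basis
for `x` of type `(λ, ε)`. -/
structure IsColoredJordanBasis (C : ZMod n → Submodule F V) (x : Module.End F V)
    (c : ColoredPartition n) (b : Module.Basis c.Box F V) : Prop where
  mem_color : ∀ p, b p ∈ C (c.boxColor p)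
  apply_first : ∀ i (h : 0 < c.len i), x (b ⟨i, ⟨0, h⟩⟩) = 0
  apply_succ : ∀ i j (h : j + 1 < c.len i),
    x (b ⟨i, ⟨j + 1, h⟩⟩) = b ⟨i, ⟨j, (Nat.lt_succ_self j).trans h⟩⟩

/-- `(λ, ε)` is a colored Jordan type of `x`. -/
def HasColoredJordanType (C : ZMod n → Submodule F V) (x : Module.End F V)
    (c : ColoredPartition n) : Prop :=
  ∃ b : Module.Basis c.Box F V, IsColoredJordanBasis C x c b

/-- The vector `v_{i,k}` (with one-based column `k`), extended by `v_{i,k} = 0` for `k ≤ 0`. -/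
noncomputable def basisVector (c : ColoredPartition n) (b : Module.Basis c.Box F V)
    (i : ℕ) (k : ℤ) : V :=
  if h : 0 < k ∧ k ≤ c.len i then b ⟨i, ⟨(k - 1).toNat, by omega⟩⟩ else 0

/-- The vector `∑ v_{i, μ_i}`, the sum being over the nonzero rows. -/
noncomputable def markedVector (P : MarkedColoredPartition n)
    (b : Module.Basis P.Box F V) : V :=
  ∑ i ∈ Finset.range P.length, basisVector P.toColoredPartition b i (P.mark i)

/-- `(v, x)` admits a normal basis. -/
def HasNormalBasis (C : ZMod n → Submodule F V) (v : V) (x : NilCone C) : Prop :=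
  ∃ (P : MarkedColoredPartition n) (b : Module.Basis P.Box F V),
    IsColoredJordanBasis C x.1 P.toColoredPartition b ∧
    v = markedVector P b ∧ P.IsGeneralizedQuasiBipartition

/-! ### Existence and independence of choices, needed to define `Ψ` -/

theorem ColoredPartition.exists_lt_iff (c : ColoredPartition n) :
    ∃ N, ∀ i, 0 < c.len i ↔ i < N := by
  classical
  refine ⟨Nat.find c.exists_len_eq_zero, fun i => ?_⟩
  rw [Nat.lt_find_iff]
  constructor
  · intro h m hm h0
    have := c.len_antitone hm
    omega
  · intro h
    exact Nat.pos_of_ne_zero (h i le_rfl)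

theorem ColoredPartition.len_pos_iff (c : ColoredPartition n) (i : ℕ) :
    0 < c.len i ↔ i < c.length := by
  obtain ⟨N, hN⟩ := c.exists_lt_iff
  have : {i | 0 < c.len i} = (Finset.range N : Set ℕ) := by
    ext i; simp [hN]
  rw [ColoredPartition.length, this, Set.ncard_coe_finset, Finset.card_range, hN]

instance ColoredPartition.finite_box (c : ColoredPartition n) : Finite c.Box := by
  refine Finite.of_injective
    (β := Σ i : Fin c.length, Fin (c.len i))
    (fun p => ⟨⟨p.1, (c.len_pos_iff p.1).1 (Fin.pos p.2)⟩, p.2⟩) ?_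
  rintro ⟨i, j⟩ ⟨i', j'⟩ h
  simp only [Sigma.mk.injEq, Fin.mk.injEq] at h
  obtain ⟨rfl, h⟩ := h
  simpa using h

theorem markedVector_eq_finsum (P : MarkedColoredPartition n) (b : Module.Basis P.Box F V) :
    markedVector P b = ∑ᶠ i, basisVector P.toColoredPartition b i (P.mark i) := by
  refine (finsum_eq_sum_of_support_subset _ fun i hi => ?_).symm
  simp only [Finset.coe_range, Set.mem_Iio, ← P.len_pos_iff]
  by_contra h
  refine hi (dif_neg ?_)
  have := P.mark_le i
  omega

/-- A linear map is controlled on each `V_m` by its values on the basis vectors of color `m`. -/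
theorem map_mem_of_colored {C D : ZMod n → Submodule F V} (hC : DirectSum.IsInternal C)
    {c : ColoredPartition n} (b : Module.Basis c.Box F V) (hb : ∀ p, b p ∈ C (c.boxColor p))
    (f : V →ₗ[F] V) (hf : ∀ p, f (b p) ∈ D (c.boxColor p)) (m : ZMod n) (v : V)
    (hv : v ∈ C m) : f v ∈ D m := by
  classical
  let S : ZMod n → Submodule F V := fun k => Submodule.span F (b '' {p | c.boxColor p = k})
  have hSC : ∀ k, S k ≤ C k := fun k => Submodule.span_le.2 (by
    rintro _ ⟨p, rfl, rfl⟩; exact hb p)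
  have hSD : ∀ k, S k ≤ (D k).comap f := fun k => Submodule.span_le.2 (by
    rintro _ ⟨p, rfl, rfl⟩; exact hf p)
  have htop : S m ⊔ ⨆ k, ⨆ _ : k ≠ m, S k = ⊤ := by
    rw [eq_top_iff, ← b.span_eq, Submodule.span_le]
    rintro _ ⟨p, rfl⟩
    have hp : b p ∈ S (c.boxColor p) := Submodule.subset_span ⟨p, rfl, rfl⟩
    by_cases h : c.boxColor p = m
    · exact Submodule.mem_sup_left (h ▸ hp)
    · exact Submodule.mem_sup_right
        ((le_iSup₂_of_le (f := fun k (_ : k ≠ m) => S k) _ h le_rfl) hp)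
  obtain ⟨a, ha, d, hd, rfl⟩ := Submodule.mem_sup.1 (htop ▸ Submodule.mem_top : v ∈ _)
  have hd' : d ∈ ⨆ k, ⨆ _ : k ≠ m, C k := (iSup₂_mono fun k _ => hSC k) hd
  have hdm : d ∈ C m := by
    have := (C m).sub_mem hv (hSC m ha)
    simpa using this
  have h0 : d = 0 :=
    Submodule.disjoint_def.1 (hC.submodule_iSupIndep m) d hdm hd'
  rw [h0, add_zero]
  exact hSD m ha

/-- Bases of any given type exist, as soon as the signatures agree. -/
theorem exists_colored_basis [FiniteDimensional F V] [NeZero n] {C : ZMod n → Submodule F V}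
    (hC : DirectSum.IsInternal C) {c : ColoredPartition n}
    (hc : c.signature = spaceSignature C) :
    ∃ b : Module.Basis c.Box F V, ∀ p, b p ∈ C (c.boxColor p) := by
  classical
  let e : ∀ m, {p : c.Box // c.boxColor p = m} ≃ Fin (Module.finrank F (C m)) := fun m =>
    (Finite.equivFin _).trans (finCongr (congrFun hc m))
  let B := hC.collectedBasis fun m => Module.finBasis F (C m)
  let E : c.Box ≃ Σ m, Fin (Module.finrank F (C m)) :=
    (Equiv.sigmaFiberEquiv c.boxColor).symm.trans (Equiv.sigmaCongrRight e)
  refine ⟨B.reindex E.symm, fun p => ?_⟩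
  rw [Module.Basis.reindex_apply]
  exact hC.collectedBasis_mem (fun m => Module.finBasis F (C m)) (E p)

/-- The endomorphism that moves every box to the box on its left. -/
noncomputable def shift (c : ColoredPartition n) (b : Module.Basis c.Box F V) : Module.End F V :=
  b.constr F fun p => basisVector c b p.1 (p.2 : ℕ)

theorem shift_isColoredJordanBasis {C : ZMod n → Submodule F V} {c : ColoredPartition n}
    {b : Module.Basis c.Box F V} (hb : ∀ p, b p ∈ C (c.boxColor p)) :
    IsColoredJordanBasis C (shift c b) c b where
  mem_color := hb
  apply_first i h := by simp [shift, basisVector]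
  apply_succ i j h := by
    rw [shift, Module.Basis.constr_basis, basisVector, dif_pos]
    · congr 3
      simp
    · constructor
      · simp only; omega
      · simp only; omega

theorem shift_mem {C : ZMod n → Submodule F V} (hC : DirectSum.IsInternal C)
    {c : ColoredPartition n} {b : Module.Basis c.Box F V}
    (hb : ∀ p, b p ∈ C (c.boxColor p)) :
    IsNilpotent (shift c b) ∧ ∀ i, ∀ v ∈ C i, shift c b v ∈ C (i + 1) := by
  have hJ := shift_isColoredJordanBasis hb
  constructor
  · have key : ∀ i j (h : j < c.len i), ((shift c b) ^ (j + 1)) (b ⟨i, ⟨j, h⟩⟩) = 0 := by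
      intro i j
      induction j with
      | zero => intro h; simpa using hJ.apply_first i h
      | succ j ih =>
        intro h
        rw [pow_succ, Module.End.mul_apply, hJ.apply_succ]
        exact ih _
    refine ⟨c.len 0, b.ext ?_⟩
    rintro ⟨i, j, h⟩
    have h0 : c.len i ≤ c.len 0 := c.len_antitone (Nat.zero_le i)
    have h1 : c.len 0 = (c.len 0 - (j + 1)) + (j + 1) := by omega
    rw [h1, pow_add, Module.End.mul_apply, key, map_zero, LinearMap.zero_apply]
  · refine map_mem_of_colored (D := fun i => C (i + 1)) hC b hb _ ?_
    rintro ⟨i, j, h⟩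
    cases j with
    | zero => rw [hJ.apply_first]; exact Submodule.zero_mem _
    | succ j =>
      rw [hJ.apply_succ]
      have : c.boxColor ⟨i, ⟨j + 1, h⟩⟩ + 1 =
          c.boxColor ⟨i, ⟨j, (Nat.lt_succ_self j).trans h⟩⟩ := by
        simp only [ColoredPartition.boxColor]; push_cast; ring
      rw [this]
      exact hb _

theorem exists_psi [FiniteDimensional F V] [NeZero n] {C : ZMod n → Submodule F V}
    (hC : DirectSum.IsInternal C) (P : MarkedOfSignature (spaceSignature C)) :
    ∃ O : Orbit C, ∃ (x : NilCone C) (b : Module.Basis P.1.Box F V),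
      IsColoredJordanBasis C x.1 P.1.toColoredPartition b ∧
      O = orbitOf C (markedVector P.1 b) x := by
  obtain ⟨b, hb⟩ := exists_colored_basis hC P.2
  exact ⟨_, ⟨shift _ b, shift_mem hC hb⟩, b, shift_isColoredJordanBasis hb, rfl⟩

/-- The orbit of `(∑ v_{i, μ_i}, x)` depends only on the class of `(λ, ε, μ)`. -/
theorem orbitOf_eq_of_weakEquiv {C : ZMod n → Submodule F V} (hC : DirectSum.IsInternal C)
    {P Q : MarkedColoredPartition n} (h : P.WeakEquiv Q) {x y : NilCone C}
    {b : Module.Basis P.Box F V} {d : Module.Basis Q.Box F V}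
    (hb : IsColoredJordanBasis C x.1 P.toColoredPartition b)
    (hd : IsColoredJordanBasis C y.1 Q.toColoredPartition d) :
    orbitOf C (markedVector P b) x = orbitOf C (markedVector Q d) y := by
  obtain ⟨σ, hσ⟩ := h
  let e : Q.Box ≃ P.Box := Equiv.sigmaCongr σ fun i => finCongr (hσ i).1
  let g : V ≃ₗ[F] V := b.equiv d e.symm
  have hgd : ∀ p, g (b (e p)) = d p := fun p => by simp [g]
  have hgb : ∀ i j (h : j < Q.len i),
      g (b ⟨σ i, ⟨j, (hσ i).1 ▸ h⟩⟩) = d ⟨i, ⟨j, h⟩⟩ := fun i j h => hgd ⟨i, ⟨j, h⟩⟩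
  have hcol : ∀ p, P.boxColor (e p) = Q.boxColor p := by
    rintro ⟨i, j, h⟩
    change P.boxColor ⟨σ i, ⟨j, _⟩⟩ = _
    simp only [ColoredPartition.boxColor, hσ i]
  have hg1 : ∀ m v, v ∈ C m → g v ∈ C m := by
    refine map_mem_of_colored (D := C) hC b hb.mem_color g.toLinearMap fun p => ?_
    obtain ⟨p, rfl⟩ := e.surjective p
    change g _ ∈ _
    rw [hgd, hcol]
    exact hd.mem_color p
  have hg2 : ∀ m v, v ∈ C m → g.symm v ∈ C m := by
    refine map_mem_of_colored (D := C) hC d hd.mem_color g.symm.toLinearMap fun p => ?_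
    change g.symm _ ∈ _
    rw [← hgd, LinearEquiv.symm_apply_apply, ← hcol]
    exact hb.mem_color _
  have hgK : g ∈ colorGroup C := fun m v =>
    ⟨fun h => by simpa using hg2 m _ h, hg1 m v⟩
  have hx : ∀ v, g (x.1 v) = y.1 (g v) := by
    have : g.toLinearMap ∘ₗ x.1 = y.1 ∘ₗ g.toLinearMap := by
      refine (b.reindex e.symm).ext ?_
      rintro ⟨i, j, h⟩
      simp only [Module.Basis.reindex_apply, Equiv.symm_symm, LinearMap.comp_apply,
        LinearEquiv.coe_coe, hgd]
      change g (x.1 (b ⟨σ i, ⟨j, (hσ i).1 ▸ h⟩⟩)) = _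
      cases j with
      | zero => rw [hb.apply_first, hd.apply_first, map_zero]
      | succ j => rw [hb.apply_succ, hd.apply_succ, hgb]
    exact fun v => LinearMap.congr_fun this v
  have hv : g (markedVector P b) = markedVector Q d := by
    rw [markedVector_eq_finsum, markedVector_eq_finsum, ← finsum_comp_equiv σ]
    have hfin : (Function.support fun i =>
        basisVector P.toColoredPartition b (σ i) (P.mark (σ i))).Finite := by
      refine ((Finset.range P.length).finite_toSet.preimage σ.injective.injOn).subset ?_
      intro i hi
      simp only [Set.mem_preimage, Finset.coe_range, Set.mem_Iio, ← P.len_pos_iff]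
      by_contra h
      refine hi (dif_neg ?_)
      omega
    have := map_finsum (g : V ≃ₗ[F] V).toLinearMap.toAddMonoidHom hfin
    refine this.trans (finsum_congr fun i => ?_)
    change g _ = _
    obtain ⟨h1, -, h3⟩ := hσ i
    have hQ := Q.mark_le i
    by_cases hpos : 0 < Q.mark i
    · have h4 := h3 (Or.inl hpos)
      rw [basisVector, basisVector, dif_pos ⟨h4 ▸ hpos, P.mark_le _⟩, dif_pos ⟨hpos, hQ⟩,
        ← hgb]
      congr 4
      rw [h4]
    · have h4 : ¬ 0 < P.mark (σ i) := fun h => hpos (by rw [h3 (Or.inr h)]; exact h)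
      rw [basisVector, basisVector, dif_neg (by tauto), dif_neg (by tauto), map_zero]
  refine (Quotient.sound ?_).symm
  refine ⟨⟨g, hgK⟩, Prod.ext hv (Subtype.ext (LinearMap.ext fun v => ?_))⟩
  change g (x.1 (g.symm v)) = y.1 v
  rw [hx, LinearEquiv.apply_symm_apply]

/-! ### The map `Ψ` -/

/-- `Ψ(λ, ε, μ)` is the orbit of `(∑ v_{i, μ_i}, x)`, where `{v_{i,j}}` is a colored Jordan basis
of type `(λ, ε)` for `x`. -/
noncomputable def psi [FiniteDimensional F V] [NeZero n] (C : ZMod n → Submodule F V)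
    (hC : DirectSum.IsInternal C) (P : MarkedOfSignature (spaceSignature C)) : Orbit C :=
  (exists_psi hC P).choose

theorem psi_eq [FiniteDimensional F V] [NeZero n] {C : ZMod n → Submodule F V}
    (hC : DirectSum.IsInternal C) (P : MarkedOfSignature (spaceSignature C)) {x : NilCone C}
    {b : Module.Basis P.1.Box F V} (hb : IsColoredJordanBasis C x.1 P.1.toColoredPartition b) :
    psi C hC P = orbitOf C (markedVector P.1 b) x := by
  obtain ⟨y, d, hd, h⟩ := (exists_psi hC P).choose_spec
  exact h.trans (orbitOf_eq_of_weakEquiv hC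
    (MarkedColoredPartition.weakEquiv_equivalence.refl P.1) hd hb)

/-- `Ψ` as a map on classes of marked colored partitions of signature `ξ(V)`. -/
noncomputable def psiClass [FiniteDimensional F V] [NeZero n] (C : ZMod n → Submodule F V)
    (hC : DirectSum.IsInternal C) : MarkedClass (spaceSignature C) → Orbit C :=
  Quotient.lift (psi C hC) fun P Q h => by
    obtain ⟨x, b, hb, hP⟩ := (exists_psi hC P).choose_spec
    obtain ⟨y, d, hd, hQ⟩ := (exists_psi hC Q).choose_spec
    exact hP.trans ((orbitOf_eq_of_weakEquiv hC h hb hd).trans hQ.symm)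

/-- The marked colored partition `P` has signature `ξ(V)` and `Ψ` sends it to `O`. -/
def CorrespondsTo [FiniteDimensional F V] [NeZero n] (C : ZMod n → Submodule F V)
    (hC : DirectSum.IsInternal C) (P : MarkedColoredPartition n) (O : Orbit C) : Prop :=
  ∃ h : P.signature = spaceSignature C, psi C hC ⟨P, h⟩ = O

end Cone

end EnhancedCone

open EnhancedCone

/-!
*Uniqueness of the type.* The number of rows of `(λ, ε)` of given length and given color of
`v_{i,1}` is read off from the dimensions of `V_a ∩ ker x ∩ im x^s`.

*Existence of the type.* If `x^k ≠ 0 = x^(k+1)`, pick a colored `u` with `x^k u ≠ 0` and a linear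
form `φ` with `φ (x^k u) = 1` that vanishes on the other colors. The largest `x`-stable subspace of
`ker φ` is a colored complement of the string `u, x u, …, x^k u`, and induction applies to it.

*Orbits.* The orbit of `(v, x)` only changes by colored automorphisms commuting with `x`. A colored
endomorphism commuting with `x` is determined by the images of the vectors `v_{i, λ_i}`, which may
be chosen freely subject to color and to being killed by `x^(λ_i)`. Adding such an endomorphism of
square zero to the identity raises a mark by `n` whenever two rows violate the inequalities of a
generalized quasi-bipartition, and raising marks terminates. For `v ∈ V_m` the component of `v` in
row `i` is `x^(λ_i - k_i) w_i` with `w_i` a generator of that row, and moving `v_{i, λ_i}` to `w_i`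
turns `∑ v_{i, k_i}` into `v`.

*Uniqueness of the marks.* If `T` commutes with `x` and `T v_{j, μ_j}` has a nonzero component along
`v_{i, k}`, then `k ≤ μ_j` and `ν_j ≤ λ_i - k`. The inequalities of a quasi-bipartition then give
`k < μ_i + n`, hence `k ≤ μ_i` if `k ≡ μ_i` modulo `n`. Applied to `T` moving one normal basis to
another, and by symmetry, this shows that the marks agree. If `v = 0` all marks are nonpositive and
larger than `-n`, and are determined by the common color `m`: this is `ρ_m(λ, ε, 0)`.
-/

namespace EnhancedCone

/-! ### Coordinates in a colored Jordan basis -/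

/-- The color of the vector `v_{i,k}`; the formula makes sense for all integers `k`, and
`P.markColor i` is its value at `k = μ_i`. -/
def ColoredPartition.columnColor {n : ℕ} (c : ColoredPartition n) (i : ℕ) (k : ℤ) : ZMod n :=
  c.color i + (((c.len i : ℤ) - k : ℤ) : ZMod n)

theorem ColoredPartition.columnColor_eq_columnColor_iff {n : ℕ} (c : ColoredPartition n) (i : ℕ)
    (k l : ℤ) : c.columnColor i k = c.columnColor i l ↔ (k : ZMod n) = l := by
  simp only [columnColor, Int.cast_sub, add_right_inj, sub_right_inj]

theorem ColoredPartition.columnColor_add {n : ℕ} (c : ColoredPartition n) (i : ℕ) (k t : ℤ) :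
    c.columnColor i (k + t) = c.columnColor i k - t := by
  simp only [columnColor]
  push_cast
  ring

section Coordinates

variable {F : Type*} [Field F] {V : Type*} [AddCommGroup V] [Module F V] {n : ℕ}
  {C : ZMod n → Submodule F V} {c : ColoredPartition n} {b : Module.Basis c.Box F V}
  {x : Module.End F V}

theorem basisVector_of_nonpos {i : ℕ} {k : ℤ} (h : k ≤ 0) : basisVector c b i k = 0 :=
  dif_neg (by omega)

theorem basisVector_add_one (i j : ℕ) (h : j < c.len i) :
    basisVector c b i (j + 1) = b ⟨i, ⟨j, h⟩⟩ := by
  rw [basisVector, dif_pos ⟨by omega, by omega⟩]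
  congr 3
  simp

theorem exists_column_eq_add_one {i : ℕ} {k : ℤ} (h0 : 0 < k) (hk : k ≤ c.len i) :
    ∃ j : ℕ, j < c.len i ∧ k = j + 1 :=
  ⟨(k - 1).toNat, by omega, by omega⟩

theorem linearMap_ext_basisVector {W : Type*} [AddCommGroup W] [Module F W] {f g : V →ₗ[F] W}
    (b : Module.Basis c.Box F V)
    (h : ∀ i (k : ℤ), 0 < k → k ≤ c.len i → f (basisVector c b i k) = g (basisVector c b i k)) :
    f = g := by
  refine b.ext ?_
  rintro ⟨i, j, hj⟩
  have := h i (j + 1) (by omega) (by omega)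
  rwa [basisVector_add_one i j hj] at this

/-- The coordinate of a vector along `v_{i,k}`, which is zero if the diagram has no box in row `i`
and (one-based) column `k`. -/
noncomputable def basisCoord (c : ColoredPartition n) (b : Module.Basis c.Box F V) (i : ℕ)
    (k : ℤ) : V →ₗ[F] F :=
  b.constr F fun p => if i = p.1 ∧ k = (p.2 : ℕ) + 1 then 1 else 0

theorem basisCoord_eq_zero {i : ℕ} {k : ℤ} (h : ¬ (0 < k ∧ k ≤ c.len i)) :
    basisCoord c b i k = 0 := by
  refine b.ext fun p => ?_
  rw [basisCoord, Module.Basis.constr_basis, if_neg, LinearMap.zero_apply]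
  rintro ⟨rfl, rfl⟩
  exact h ⟨by omega, by omega⟩

theorem mem_column_of_basisCoord_ne_zero {i : ℕ} {k : ℤ} {u : V} (h : basisCoord c b i k u ≠ 0) :
    0 < k ∧ k ≤ c.len i := by
  by_contra hik
  exact h (by rw [basisCoord_eq_zero hik, LinearMap.zero_apply])

theorem basisCoord_basisVector {i : ℕ} {k : ℤ} (h0 : 0 < k) (hk : k ≤ c.len i) (i' : ℕ) (k' : ℤ) :
    basisCoord c b i' k' (basisVector c b i k) = if i' = i ∧ k' = k then 1 else 0 := by
  obtain ⟨j, hj, rfl⟩ := exists_column_eq_add_one h0 hk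
  rw [basisVector_add_one i j hj, basisCoord, Module.Basis.constr_basis]

theorem basisCoord_add_one (i j : ℕ) (h : j < c.len i) :
    basisCoord c b i (j + 1) = b.coord ⟨i, ⟨j, h⟩⟩ := by
  classical
  refine b.ext ?_
  rintro ⟨i', j', h'⟩
  rw [basisCoord, Module.Basis.constr_basis, Module.Basis.coord_apply, Module.Basis.repr_self,
    Finsupp.single_apply]
  refine if_congr ⟨?_, ?_⟩ rfl rfl
  · rintro ⟨rfl, hj⟩
    obtain rfl : j' = j := by simpa using hj.symm
    rfl
  · rintro ⟨⟩
    exact ⟨rfl, rfl⟩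

theorem repr_ne_zero_iff {u : V} (i j : ℕ) (h : j < c.len i) :
    b.repr u ⟨i, ⟨j, h⟩⟩ ≠ 0 ↔ basisCoord c b i (j + 1) u ≠ 0 := by
  rw [basisCoord_add_one i j h, Module.Basis.coord_apply]

theorem eq_zero_of_basisCoord_eq_zero {u : V} (h : ∀ i k, basisCoord c b i k u = 0) : u = 0 := by
  refine b.ext_elem ?_
  rintro ⟨i, j, hj⟩
  simpa [basisCoord_add_one i j hj] using h i (j + 1)

namespace IsColoredJordanBasis

theorem basisVector_mem (hb : IsColoredJordanBasis C x c b) (i : ℕ) (k : ℤ) :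
    basisVector c b i k ∈ C (c.columnColor i k) := by
  by_cases h : 0 < k ∧ k ≤ c.len i
  · obtain ⟨j, hj, rfl⟩ := exists_column_eq_add_one h.1 h.2
    rw [basisVector_add_one i j hj]
    exact hb.mem_color ⟨i, ⟨j, hj⟩⟩
  · rw [basisVector, dif_neg h]
    exact Submodule.zero_mem _

theorem apply_basisVector (hb : IsColoredJordanBasis C x c b) {i : ℕ} {k : ℤ}
    (hk : k ≤ c.len i) : x (basisVector c b i k) = basisVector c b i (k - 1) := by
  rcases lt_or_ge 0 k with h0 | h0
  · obtain ⟨j, hj, rfl⟩ := exists_column_eq_add_one h0 hk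
    rw [basisVector_add_one i j hj, add_sub_cancel_right]
    cases j with
    | zero => rw [hb.apply_first, basisVector_of_nonpos (by simp)]
    | succ j => rw [hb.apply_succ, Nat.cast_succ, basisVector_add_one i j (by omega)]
  · rw [basisVector_of_nonpos h0, basisVector_of_nonpos (by omega), map_zero]

theorem pow_apply_basisVector (hb : IsColoredJordanBasis C x c b) {i : ℕ} {k : ℤ}
    (hk : k ≤ c.len i) (s : ℕ) :
    (x ^ s) (basisVector c b i k) = basisVector c b i (k - s) := by
  induction s with
  | zero => simp
  | succ s ih =>
    rw [pow_succ', Module.End.mul_apply, ih, hb.apply_basisVector (by omega)]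
    congr 1
    push_cast
    ring

theorem basisCoord_apply (hb : IsColoredJordanBasis C x c b) {i : ℕ} {k : ℤ} (h0 : 0 < k)
    (u : V) : basisCoord c b i k (x u) = basisCoord c b i (k + 1) u := by
  suffices basisCoord c b i k ∘ₗ x = basisCoord c b i (k + 1) from LinearMap.congr_fun this u
  refine linearMap_ext_basisVector b fun i' k' h0' hk' => ?_
  rw [LinearMap.comp_apply, hb.apply_basisVector hk', basisCoord_basisVector h0' hk']
  rcases lt_or_ge 0 (k' - 1) with h1 | h1
  · rw [basisCoord_basisVector h1 (by omega)]
    refine if_congr (and_congr_right fun _ => ?_) rfl rfl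
    omega
  · rw [basisVector_of_nonpos h1, map_zero, if_neg (by omega)]

theorem basisCoord_pow_apply (hb : IsColoredJordanBasis C x c b) {i : ℕ} {k : ℤ} (h0 : 0 < k)
    (s : ℕ) (u : V) : basisCoord c b i k ((x ^ s) u) = basisCoord c b i (k + s) u := by
  induction s generalizing u with
  | zero => simp
  | succ s ih =>
    rw [pow_succ, Module.End.mul_apply, ih, hb.basisCoord_apply (by omega)]
    congr 2
    push_cast
    ring

theorem le_of_basisCoord_ne_zero (hb : IsColoredJordanBasis C x c b) {s : ℕ} {u : V}
    (hu : (x ^ s) u = 0) {i : ℕ} {k : ℤ} (h : basisCoord c b i k u ≠ 0) : k ≤ s := by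
  by_contra! hks
  refine h ?_
  have := hb.basisCoord_pow_apply (i := i) (k := k - s) (by omega) s u
  rwa [hu, map_zero, sub_add_cancel, eq_comm] at this

theorem add_le_of_basisCoord_pow_apply_ne_zero (hb : IsColoredJordanBasis C x c b) {s : ℕ} {u : V}
    {i : ℕ} {k : ℤ} (h : basisCoord c b i k ((x ^ s) u) ≠ 0) : k + s ≤ c.len i := by
  rw [hb.basisCoord_pow_apply (mem_column_of_basisCoord_ne_zero h).1] at h
  exact (mem_column_of_basisCoord_ne_zero h).2

end IsColoredJordanBasis

theorem eq_span_image_boxColor (hC : DirectSum.IsInternal C)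
    (hb : ∀ p, b p ∈ C (c.boxColor p)) (m : ZMod n) :
    C m = Submodule.span F (b '' {p | c.boxColor p = m}) := by
  refine le_antisymm (fun u hu => ?_) (Submodule.span_le.2 ?_)
  · exact map_mem_of_colored (D := fun m => Submodule.span F (b '' {p | c.boxColor p = m})) hC b hb
      LinearMap.id (fun p => Submodule.subset_span (Set.mem_image_of_mem b rfl)) m u hu
  · rintro _ ⟨p, rfl, rfl⟩
    exact hb p

theorem finrank_span_image_box (S : Set c.Box) :
    Module.finrank F (Submodule.span F (b '' S)) = Nat.card S := by
  have := Fintype.ofFinite S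
  have h := finrank_span_eq_card (R := F) (b := fun p : S => b p)
    (b.linearIndependent.comp _ Subtype.val_injective)
  rw [Nat.card_eq_fintype_card, ← h, Set.image_eq_range]

namespace IsColoredJordanBasis

theorem columnColor_eq_of_basisCoord_ne_zero (hC : DirectSum.IsInternal C)
    (hb : IsColoredJordanBasis C x c b) {m : ZMod n} {u : V} (hu : u ∈ C m) {i : ℕ} {k : ℤ}
    (h : basisCoord c b i k u ≠ 0) : c.columnColor i k = m := by
  obtain ⟨h0, hk⟩ := mem_column_of_basisCoord_ne_zero h
  obtain ⟨j, hj, rfl⟩ := exists_column_eq_add_one h0 hk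
  rw [eq_span_image_boxColor hC hb.mem_color, Module.Basis.mem_span_image] at hu
  exact hu (Finsupp.mem_support_iff.2 ((repr_ne_zero_iff i j hj).2 h))

theorem signature_eq (hC : DirectSum.IsInternal C) (hb : IsColoredJordanBasis C x c b) :
    c.signature = spaceSignature C := by
  funext m
  rw [spaceSignature, eq_span_image_boxColor hC hb.mem_color m, finrank_span_image_box]
  rfl

end IsColoredJordanBasis

end Coordinates

/-! ### Uniqueness of the colored Jordan type -/

section Socle

variable {F : Type*} [Field F] {V : Type*} [AddCommGroup V] [Module F V] {n : ℕ}
  {C : ZMod n → Submodule F V} {c : ColoredPartition n} {b : Module.Basis c.Box F V}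
  {x : Module.End F V}

/-- The vectors of color `a` in `ker x ∩ im x ^ s`. Their dimensions determine the colored Jordan
type of `x`, see `IsColoredJordanBasis.finrank_socle`. -/
def socle (C : ZMod n → Submodule F V) (x : Module.End F V) (s : ℕ) (a : ZMod n) :
    Submodule F V :=
  LinearMap.ker x ⊓ LinearMap.range (x ^ s) ⊓ C a

namespace IsColoredJordanBasis

theorem eq_one_of_basisCoord_ne_zero (hb : IsColoredJordanBasis C x c b) {u : V} (hu : x u = 0)
    {i : ℕ} {k : ℤ} (h : basisCoord c b i k u ≠ 0) : k = 1 := by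
  have h0 := (mem_column_of_basisCoord_ne_zero h).1
  have h1 := hb.le_of_basisCoord_ne_zero (s := 1) (by rwa [pow_one]) h
  push_cast at h1
  omega

theorem ker_eq_span (hb : IsColoredJordanBasis C x c b) :
    LinearMap.ker x = Submodule.span F (b '' {p | (p.2 : ℕ) = 0}) := by
  refine le_antisymm (fun u hu => ?_) (Submodule.span_le.2 ?_)
  · rw [Module.Basis.mem_span_image]
    rintro ⟨i, j, hj⟩ hp
    have h := (repr_ne_zero_iff i j hj).1 (Finsupp.mem_support_iff.1 hp)
    simpa using hb.eq_one_of_basisCoord_ne_zero hu h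
  · rintro _ ⟨⟨i, j, hj⟩, h0, rfl⟩
    obtain rfl : j = 0 := h0
    exact hb.apply_first i hj

theorem socle_eq_span (hC : DirectSum.IsInternal C) (hb : IsColoredJordanBasis C x c b) (s : ℕ)
    (a : ZMod n) : socle C x s a = Submodule.span F
      (b '' {p | (p.2 : ℕ) = 0 ∧ s < c.len p.1 ∧ c.columnColor p.1 1 = a}) := by
  refine le_antisymm ?_ (Submodule.span_le.2 ?_)
  · rintro _ ⟨⟨hker, w, rfl⟩, ha⟩
    rw [Module.Basis.mem_span_image]
    rintro ⟨i, j, hj⟩ hp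
    have h := (repr_ne_zero_iff i j hj).1 (Finsupp.mem_support_iff.1 hp)
    have hj0 := hb.eq_one_of_basisCoord_ne_zero hker h
    have hs := hb.add_le_of_basisCoord_pow_apply_ne_zero h
    rw [hj0] at h hs
    exact ⟨by simpa using hj0, by simp only; omega,
      hb.columnColor_eq_of_basisCoord_ne_zero hC ha h⟩
  · rintro _ ⟨⟨i, j, hj⟩, ⟨h0, hs, rfl⟩, rfl⟩
    obtain rfl : j = 0 := h0
    have hfirst : b ⟨i, ⟨0, hj⟩⟩ = basisVector c b i 1 := (basisVector_add_one i 0 hj).symm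
    refine ⟨⟨hb.apply_first i hj, basisVector c b i (s + 1), ?_⟩, ?_⟩
    · rw [hb.pow_apply_basisVector (by simp only at hs; omega), add_sub_cancel_left, hfirst]
    · rw [hfirst]
      exact hb.basisVector_mem i 1

theorem finrank_socle (hC : DirectSum.IsInternal C) (hb : IsColoredJordanBasis C x c b) (s : ℕ)
    (a : ZMod n) :
    Module.finrank F (socle C x s a) = {i | s < c.len i ∧ c.columnColor i 1 = a}.ncard := by
  rw [hb.socle_eq_span hC, finrank_span_image_box, ← Nat.card_coe_set_eq]
  refine Nat.card_congr
    { toFun := fun p => ⟨p.1.1, p.2.2⟩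
      invFun := fun i => ⟨⟨i.1, ⟨0, (Nat.zero_le s).trans_lt i.2.1⟩⟩, rfl, i.2⟩
      left_inv := ?_
      right_inv := fun i => rfl }
  rintro ⟨⟨i, j, hj⟩, h0, h⟩
  obtain rfl : j = 0 := h0
  rfl

end IsColoredJordanBasis

end Socle

theorem exists_perm_of_encard_fiber_eq {α β : Type*} [Countable α] {f g : α → β}
    (h : ∀ t, {i | f i = t}.encard = {i | g i = t}.encard) :
    ∃ σ : Equiv.Perm α, ∀ i, g i = f (σ i) := by
  have hequiv : ∀ t, Nonempty ({i | g i = t} ≃ {i | f i = t}) := fun t => by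
    rcases Set.finite_or_infinite {i | f i = t} with hf | hf
    · have hg : {i | g i = t}.Finite := by
        rwa [← Set.encard_lt_top_iff, ← h, Set.encard_lt_top_iff]
      have := hf.to_subtype
      have := hg.to_subtype
      exact Finite.card_eq.1 (congrArg ENat.toNat (h t)).symm
    · have hg : {i | g i = t}.Infinite := by
        rwa [← Set.encard_eq_top_iff, ← h, Set.encard_eq_top_iff]
      have := hf.to_subtype
      have := hg.to_subtype
      exact nonempty_equiv_of_countable
  let e : ∀ t, {i // g i = t} ≃ {i // f i = t} := fun t => (hequiv t).some
  exact ⟨Equiv.ofFiberEquiv e, fun i => (Equiv.ofFiberEquiv_map e i).symm⟩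

namespace ColoredPartition

variable {n : ℕ}

/-- Equality of colored partitions up to a permutation of the rows. -/
def RowEquiv (c d : ColoredPartition n) : Prop :=
  ∃ σ : Equiv.Perm ℕ, ∀ i, d.len i = c.len (σ i) ∧ d.color i = c.color (σ i)

theorem RowEquiv.symm {c d : ColoredPartition n} (h : c.RowEquiv d) : d.RowEquiv c := by
  obtain ⟨σ, hσ⟩ := h
  refine ⟨σ.symm, σ.surjective.forall.2 fun i => ?_⟩
  rw [σ.symm_apply_apply]
  exact ⟨(hσ i).1.symm, (hσ i).2.symm⟩

theorem finite_len_pos (c : ColoredPartition n) : {i | 0 < c.len i}.Finite :=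
  (Set.finite_Iio c.length).subset fun i hi => (c.len_pos_iff i).1 hi

theorem infinite_len_eq_zero (c : ColoredPartition n) (e : ZMod n) :
    {i | c.len i = 0 ∧ c.color i = e}.Infinite :=
  ((c.infinite_color e).sdiff c.finite_len_pos).mono fun _ hi =>
    ⟨Nat.eq_zero_of_not_pos hi.2, hi.1⟩

theorem ncard_len_eq_add_one (c : ColoredPartition n) (l : ℕ) (a : ZMod n) :
    {i | c.len i = l + 1 ∧ c.columnColor i 1 = a}.ncard =
      {i | l < c.len i ∧ c.columnColor i 1 = a}.ncard -
        {i | l + 1 < c.len i ∧ c.columnColor i 1 = a}.ncard := by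
  have hfin : {i | l + 1 < c.len i ∧ c.columnColor i 1 = a}.Finite :=
    c.finite_len_pos.subset fun i hi => (Nat.zero_le _).trans_lt hi.1
  have hsub : {i | l + 1 < c.len i ∧ c.columnColor i 1 = a} ⊆
      {i | l < c.len i ∧ c.columnColor i 1 = a} :=
    fun i hi => ⟨(Nat.lt_succ_self l).trans hi.1, hi.2⟩
  rw [← Set.ncard_sdiff hsub hfin]
  congr 1
  ext i
  simp only [Set.mem_sdiff, Set.mem_ofPred_eq]
  grind

theorem rowEquiv_of_ncard_eq {c d : ColoredPartition n}
    (h : ∀ l a, {i | l < c.len i ∧ c.columnColor i 1 = a}.ncard =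
      {i | l < d.len i ∧ d.columnColor i 1 = a}.ncard) : c.RowEquiv d := by
  have hinf : ∀ (c : ColoredPartition n) (a : ZMod n),
      {i | (c.len i, c.columnColor i 1) = (0, a)}.Infinite := fun c a => by
    refine (c.infinite_len_eq_zero (a + 1)).mono fun i hi => ?_
    simp [columnColor, hi.1, hi.2]
  have hfin : ∀ (c : ColoredPartition n) (l : ℕ) (a : ZMod n),
      {i | (c.len i, c.columnColor i 1) = (l + 1, a)}.Finite := fun c l a =>
    c.finite_len_pos.subset fun i hi => by
      have := congrArg Prod.fst hi
      simp only [Set.mem_ofPred_eq] at this ⊢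
      omega
  obtain ⟨σ, hσ⟩ := exists_perm_of_encard_fiber_eq
      (f := fun i => (c.len i, c.columnColor i 1)) (g := fun i => (d.len i, d.columnColor i 1)) (by
    rintro ⟨_ | l, a⟩
    · rw [(hinf c a).encard_eq, (hinf d a).encard_eq]
    · rw [← (hfin c l a).cast_ncard_eq, ← (hfin d l a).cast_ncard_eq]
      simp only [Prod.mk.injEq, ncard_len_eq_add_one, h])
  simp only [Prod.mk.injEq] at hσ
  refine ⟨σ, fun i => ⟨(hσ i).1, ?_⟩⟩
  have := (hσ i).2
  rwa [columnColor, columnColor, (hσ i).1, add_left_inj] at this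

end ColoredPartition

namespace HasColoredJordanType

variable {F : Type*} [Field F] {V : Type*} [AddCommGroup V] [Module F V] {n : ℕ}
  {C : ZMod n → Submodule F V} {c d : ColoredPartition n} {x : Module.End F V}

theorem rowEquiv (hC : DirectSum.IsInternal C) (hc : HasColoredJordanType C x c)
    (hd : HasColoredJordanType C x d) : c.RowEquiv d := by
  obtain ⟨b, hb⟩ := hc
  obtain ⟨b', hb'⟩ := hd
  exact ColoredPartition.rowEquiv_of_ncard_eq fun l a =>
    (hb.finrank_socle hC l a).symm.trans (hb'.finrank_socle hC l a)

theorem of_rowEquiv (hc : HasColoredJordanType C x c) (h : c.RowEquiv d) :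
    HasColoredJordanType C x d := by
  obtain ⟨b, hb⟩ := hc
  obtain ⟨σ, hσ⟩ := h
  let e : d.Box ≃ c.Box := Equiv.sigmaCongr σ fun i => finCongr (hσ i).1
  have he : ∀ i j (h : j < d.len i),
      b.reindex e.symm ⟨i, ⟨j, h⟩⟩ = b ⟨σ i, ⟨j, (hσ i).1 ▸ h⟩⟩ := fun i j h =>
    b.reindex_apply e.symm _
  refine ⟨b.reindex e.symm, ?_, fun i h => ?_, fun i j h => ?_⟩
  · rintro ⟨i, j, h⟩
    have hcolor : d.boxColor ⟨i, ⟨j, h⟩⟩ = c.boxColor ⟨σ i, ⟨j, (hσ i).1 ▸ h⟩⟩ := by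
      simp only [ColoredPartition.boxColor, (hσ i).1, (hσ i).2]
    rw [he, hcolor]
    exact hb.mem_color _
  · rw [he, hb.apply_first]
  · rw [he, he, hb.apply_succ]

end HasColoredJordanType

section Transport

variable {F : Type*} [Field F] {V : Type*} [AddCommGroup V] [Module F V] {n : ℕ}
  {C : ZMod n → Submodule F V}

theorem orbitOf_eq_iff {v w : V} {x y : NilCone C} :
    orbitOf C v x = orbitOf C w y ↔
      ∃ g ∈ colorGroup C, g w = v ∧ ∀ u, g (y.1 u) = x.1 (g u) := by
  constructor
  · intro h
    obtain ⟨g, hg⟩ := Quotient.exact h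
    refine ⟨g.1, g.2, congrArg Prod.fst hg, fun u => ?_⟩
    have hconj : g • y = x := congrArg Prod.snd hg
    rw [← hconj]
    change g.1 (y.1 u) = g.1 (y.1 (g.1.symm (g.1 u)))
    rw [LinearEquiv.symm_apply_apply]
  · rintro ⟨g, hg, hv, hx⟩
    refine Quotient.sound ⟨⟨g, hg⟩, Prod.ext hv (Subtype.ext (LinearMap.ext fun u => ?_))⟩
    change g (y.1 (g.symm u)) = x.1 u
    rw [hx, LinearEquiv.apply_symm_apply]

theorem basisVector_map {c : ColoredPartition n} (b : Module.Basis c.Box F V) (g : V ≃ₗ[F] V)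
    (i : ℕ) (k : ℤ) : basisVector c (b.map g) i k = g (basisVector c b i k) := by
  unfold basisVector
  split_ifs
  · rw [Module.Basis.map_apply]
  · rw [map_zero]

theorem markedVector_map (P : MarkedColoredPartition n) (b : Module.Basis P.Box F V)
    (g : V ≃ₗ[F] V) : markedVector P (b.map g) = g (markedVector P b) := by
  simp only [markedVector, map_sum, basisVector_map]

theorem IsColoredJordanBasis.map {c : ColoredPartition n} {b : Module.Basis c.Box F V}
    {x y : Module.End F V} (hb : IsColoredJordanBasis C y c b) {g : V ≃ₗ[F] V}
    (hg : g ∈ colorGroup C) (hx : ∀ u, g (y u) = x (g u)) :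
    IsColoredJordanBasis C x c (b.map g) where
  mem_color p := (hg _ _).2 (hb.mem_color p)
  apply_first i h := by rw [Module.Basis.map_apply, ← hx, hb.apply_first, map_zero]
  apply_succ i j h := by
    rw [Module.Basis.map_apply, ← hx, hb.apply_succ, Module.Basis.map_apply]

theorem correspondsTo_orbitOf_iff [FiniteDimensional F V] [NeZero n] (hC : DirectSum.IsInternal C)
    {P : MarkedColoredPartition n} {v : V} {x : NilCone C} :
    CorrespondsTo C hC P (orbitOf C v x) ↔
      ∃ b : Module.Basis P.Box F V,
        IsColoredJordanBasis C x.1 P.toColoredPartition b ∧ v = markedVector P b := by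
  constructor
  · rintro ⟨h, hP⟩
    obtain ⟨O, y, b, hb, -⟩ := exists_psi hC ⟨P, h⟩
    rw [psi_eq hC ⟨P, h⟩ hb, eq_comm, orbitOf_eq_iff] at hP
    obtain ⟨g, hg, hv, hx⟩ := hP
    exact ⟨b.map g, hb.map hg hx, by rw [markedVector_map, hv]⟩
  · rintro ⟨b, hb, rfl⟩
    exact ⟨hb.signature_eq hC, psi_eq hC _ hb⟩

end Transport

/-! ### The centralizer of a colored nilpotent endomorphism -/

section Centralizer

variable {F : Type*} [Field F] {V : Type*} [AddCommGroup V] [Module F V] {n : ℕ}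
  {C : ZMod n → Submodule F V} {c : ColoredPartition n} {b : Module.Basis c.Box F V}
  {x T : Module.End F V}

/-- The algebra of endomorphisms that commute with `x` and preserve every `V_i`. Its injective
elements move `(v, x)` within its orbit, see `orbitOf_apply_eq`. -/
def coloredCentralizer (C : ZMod n → Submodule F V) (x : Module.End F V) :
    Subalgebra F (Module.End F V) where
  carrier := {T | Commute T x ∧ ∀ m, ∀ v ∈ C m, T v ∈ C m}
  mul_mem' hS hT := ⟨hS.1.mul_left hT.1, fun m v hv => hS.2 m _ (hT.2 m v hv)⟩
  add_mem' hS hT := ⟨hS.1.add_left hT.1, fun m v hv => (C m).add_mem (hS.2 m v hv) (hT.2 m v hv)⟩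
  algebraMap_mem' r := ⟨Algebra.commute_algebraMap_left r x, fun m _ hv => (C m).smul_mem r hv⟩

theorem orbitOf_apply_eq [FiniteDimensional F V] {x : NilCone C}
    (hT : T ∈ coloredCentralizer C x.1) (hinj : Function.Injective T) (v : V) :
    orbitOf C (T v) x = orbitOf C v x := by
  refine orbitOf_eq_iff.2 ⟨LinearEquiv.ofInjectiveEndo T hinj, fun m u => ⟨fun h => ?_, hT.2 m u⟩,
    rfl, LinearMap.congr_fun hT.1.eq⟩
  have hmap : (C m).map T = C m :=
    Submodule.eq_of_le_of_finrank_eq (Submodule.map_le_iff_le_comap.2 (hT.2 m))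
      (Submodule.equivMapOfInjective T hinj (C m)).finrank_eq.symm
  rw [← hmap] at h
  obtain ⟨w, hw, hwu⟩ := h
  rwa [← hinj hwu]

theorem orbitOf_add_apply_eq [FiniteDimensional F V] {x : NilCone C}
    (hT : T ∈ coloredCentralizer C x.1) (hnil : IsNilpotent T) (v : V) :
    orbitOf C (v + T v) x = orbitOf C v x :=
  orbitOf_apply_eq (add_mem (one_mem _) hT)
    ((Module.End.isUnit_iff _).1 hnil.isUnit_one_add).injective v

theorem injective_of_commute_of_ker_inf_ker_eq_bot (hTx : Commute T x) (hx : IsNilpotent x)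
    (hker : LinearMap.ker x ⊓ LinearMap.ker T = ⊥) : Function.Injective T := by
  obtain ⟨k, hk⟩ := hx
  have hpow : ∀ s u, (x ^ s) u = 0 → T u = 0 → u = 0 := by
    intro s
    induction s with
    | zero => exact fun u hu _ => hu
    | succ s ih =>
      intro u hu hTu
      have hxu : x u = 0 := by
        refine ih (x u) ?_ ?_
        · rwa [pow_succ, Module.End.mul_apply] at hu
        · rw [← Module.End.mul_apply, hTx.eq, Module.End.mul_apply, hTu, map_zero]
      exact (Submodule.mem_bot F).1 (hker ▸ ⟨hxu, hTu⟩)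
  rw [injective_iff_map_eq_zero]
  exact fun u => hpow k u (by rw [hk, LinearMap.zero_apply])

theorem pow_apply_mem (hx : ∀ m, ∀ v ∈ C m, x v ∈ C (m + 1)) {m : ZMod n} {v : V} (hv : v ∈ C m)
    (s : ℕ) : (x ^ s) v ∈ C (m + s) := by
  induction s with
  | zero => simpa using hv
  | succ s ih =>
    rw [pow_succ', Module.End.mul_apply, Nat.cast_succ, ← add_assoc]
    exact hx _ _ ih

namespace IsColoredJordanBasis

theorem apply_mem (hC : DirectSum.IsInternal C) (hb : IsColoredJordanBasis C x c b) (m : ZMod n)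
    (v : V) (hv : v ∈ C m) : x v ∈ C (m + 1) := by
  refine map_mem_of_colored (D := fun m => C (m + 1)) hC b hb.mem_color x ?_ m v hv
  rintro ⟨i, j, hj⟩
  have hcolor : c.boxColor ⟨i, ⟨j, hj⟩⟩ + 1 = c.columnColor i ((j + 1 : ℤ) - 1) := by
    simp only [ColoredPartition.boxColor, ColoredPartition.columnColor]
    push_cast
    ring
  rw [hcolor, ← basisVector_add_one i j hj, hb.apply_basisVector (by omega)]
  exact hb.basisVector_mem i _

theorem pow_apply_mem (hC : DirectSum.IsInternal C) (hb : IsColoredJordanBasis C x c b)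
    {m : ZMod n} {v : V} (hv : v ∈ C m) (s : ℕ) : (x ^ s) v ∈ C (m + s) :=
  EnhancedCone.pow_apply_mem (hb.apply_mem hC) hv s

theorem le_and_add_le_of_commute (hb : IsColoredJordanBasis C x c b) (hTx : Commute T x) {i j : ℕ}
    {k l : ℤ} (hl : l ≤ c.len j) (h : basisCoord c b i k (T (basisVector c b j l)) ≠ 0) :
    k ≤ l ∧ k + (c.len j - l) ≤ c.len i := by
  have hTpow : ∀ s u, (x ^ s) (T u) = T ((x ^ s) u) := fun s =>
    LinearMap.congr_fun (hTx.pow_right s).eq.symm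
  have hl0 : 0 < l := by
    by_contra! hl0
    exact h (by rw [basisVector_of_nonpos hl0, map_zero, map_zero])
  constructor
  · have hkill : (x ^ l.toNat) (T (basisVector c b j l)) = 0 := by
      rw [hTpow, hb.pow_apply_basisVector hl, basisVector_of_nonpos (by omega), map_zero]
    have := hb.le_of_basisCoord_ne_zero hkill h
    omega
  · have hlast : T (basisVector c b j l) =
        (x ^ (c.len j - l).toNat) (T (basisVector c b j (c.len j))) := by
      rw [hTpow, hb.pow_apply_basisVector le_rfl, Int.toNat_of_nonneg (by omega), sub_sub_cancel]
    rw [hlast] at h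
    have := hb.add_le_of_basisCoord_pow_apply_ne_zero h
    omega

end IsColoredJordanBasis

/-- The endomorphism `v_{i,k} ↦ x ^ (λ_i - k) w_i`. If `x ^ λ_i w_i = 0` for all `i`, it is the
endomorphism commuting with `x` that sends the last vector of each row `i` to `w_i`. -/
noncomputable def rowExtension (c : ColoredPartition n) (b : Module.Basis c.Box F V)
    (x : Module.End F V) (w : ℕ → V) : Module.End F V :=
  b.constr F fun p => (x ^ (c.len p.1 - 1 - p.2)) (w p.1)

theorem rowExtension_basisVector {w : ℕ → V} {i : ℕ} (hw : (x ^ c.len i) (w i) = 0) {k : ℤ}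
    (hk : k ≤ c.len i) :
    rowExtension c b x w (basisVector c b i k) = (x ^ ((c.len i : ℤ) - k).toNat) (w i) := by
  rcases lt_or_ge 0 k with h0 | h0
  · obtain ⟨j, hj, rfl⟩ := exists_column_eq_add_one h0 hk
    rw [rowExtension, basisVector_add_one i j hj, Module.Basis.constr_basis]
    congr 2
    simp only
    omega
  · have hexp : ((c.len i : ℤ) - k).toNat = (-k).toNat + c.len i := by omega
    rw [basisVector_of_nonpos h0, map_zero, hexp, pow_add, Module.End.mul_apply, hw, map_zero]

theorem IsColoredJordanBasis.rowExtension_mem (hC : DirectSum.IsInternal C)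
    (hb : IsColoredJordanBasis C x c b) {w : ℕ → V} (hw : ∀ i, (x ^ c.len i) (w i) = 0)
    (hcolor : ∀ i, w i ∈ C (c.color i)) : rowExtension c b x w ∈ coloredCentralizer C x := by
  constructor
  · refine linearMap_ext_basisVector b fun i k _ hk => ?_
    have hexp : ((c.len i : ℤ) - (k - 1)).toNat = ((c.len i : ℤ) - k).toNat + 1 := by omega
    rw [Module.End.mul_apply, Module.End.mul_apply, hb.apply_basisVector hk,
      rowExtension_basisVector (hw i) (by omega), rowExtension_basisVector (hw i) hk, hexp,
      pow_succ', Module.End.mul_apply]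
  · refine map_mem_of_colored (D := C) hC b hb.mem_color _ ?_
    rintro ⟨i, j, hj⟩
    have hbox : c.boxColor ⟨i, ⟨j, hj⟩⟩ = c.color i + ((c.len i - 1 - j : ℕ) : ZMod n) := by
      rw [ColoredPartition.boxColor, ← Int.cast_natCast (R := ZMod n) (c.len i - 1 - j)]
      congr 2
      simp only
      omega
    rw [hbox, rowExtension, Module.Basis.constr_basis]
    exact hb.pow_apply_mem hC (hcolor i) _

/-- The endomorphism that sends the last vector of row `s` to `u` and kills the other rows; it
commutes with `x` if `x ^ λ_s u = 0`. -/
noncomputable def rowTransfer (c : ColoredPartition n) (b : Module.Basis c.Box F V)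
    (x : Module.End F V) (s : ℕ) (u : V) : Module.End F V :=
  rowExtension c b x (Pi.single s u)

section RowTransfer

variable {s : ℕ} {u : V}

theorem pow_apply_single (hu : (x ^ c.len s) u = 0) (i : ℕ) :
    (x ^ c.len i) (Pi.single (M := fun _ : ℕ => V) s u i) = 0 := by
  rcases eq_or_ne i s with rfl | hi
  · rwa [Pi.single_eq_same]
  · rw [Pi.single_eq_of_ne hi, map_zero]

theorem rowTransfer_basisVector_self (hu : (x ^ c.len s) u = 0) {k : ℤ} (hk : k ≤ c.len s) :
    rowTransfer c b x s u (basisVector c b s k) = (x ^ ((c.len s : ℤ) - k).toNat) u := by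
  rw [rowTransfer, rowExtension_basisVector (pow_apply_single hu s) hk, Pi.single_eq_same]

theorem rowTransfer_basisVector_of_ne {i : ℕ} (hi : i ≠ s) (k : ℤ) :
    rowTransfer c b x s u (basisVector c b i k) = 0 := by
  by_cases hk : 0 < k ∧ k ≤ c.len i
  · rw [rowTransfer, rowExtension_basisVector _ hk.2] <;>
      rw [Pi.single_eq_of_ne hi, map_zero]
  · rw [basisVector, dif_neg hk, map_zero]

theorem IsColoredJordanBasis.rowTransfer_mem (hC : DirectSum.IsInternal C)
    (hb : IsColoredJordanBasis C x c b) (hu : (x ^ c.len s) u = 0) (hcolor : u ∈ C (c.color s)) :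
    rowTransfer c b x s u ∈ coloredCentralizer C x := by
  refine hb.rowExtension_mem hC (pow_apply_single hu) fun i => ?_
  rcases eq_or_ne i s with rfl | hi
  · rwa [Pi.single_eq_same]
  · rw [Pi.single_eq_of_ne hi]
    exact Submodule.zero_mem _

end RowTransfer

end Centralizer

/-! ### Uniqueness of the marks -/

theorem le_of_lt_add_of_intCast_eq {n : ℕ} {k l : ℤ} (h : k < l + n)
    (hkl : (k : ZMod n) = (l : ZMod n)) : k ≤ l := by
  by_contra! hlt
  have hdvd : (n : ℤ) ∣ k - l := (ZMod.intCast_eq_intCast_iff_dvd_sub l k n).1 hkl.symm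
  have := Int.le_of_dvd (by omega) hdvd
  omega

theorem MarkedColoredPartition.RowEquiv.weakEquiv {n : ℕ} {P Q : MarkedColoredPartition n}
    (h : P.RowEquiv Q) : P.WeakEquiv Q := by
  obtain ⟨σ, hσ⟩ := h
  exact ⟨σ, fun i => ⟨(hσ i).1, (hσ i).2.1, fun _ => (hσ i).2.2⟩⟩

theorem ColoredPartition.columnColor_congr {n : ℕ} {c d : ColoredPartition n} {i j : ℕ} {k : ℤ}
    (hlen : d.len i = c.len j) (hcolor : d.color i = c.color j) :
    d.columnColor i k = c.columnColor j k := by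
  rw [columnColor, columnColor, hlen, hcolor]

section RowSum

variable {F : Type*} [Field F] {V : Type*} [AddCommGroup V] [Module F V] {n : ℕ}
  {C : ZMod n → Submodule F V} {c : ColoredPartition n} {b : Module.Basis c.Box F V}
  {x : Module.End F V} {μ : ℕ → ℤ}

/-- The vector `∑ v_{i, μ_i}`, the sum being over the nonzero rows. For a marked colored partition
this is `markedVector`; here `μ` is not required to be a marking. -/
noncomputable def rowSum (c : ColoredPartition n) (b : Module.Basis c.Box F V) (μ : ℕ → ℤ) : V :=
  ∑ i ∈ Finset.range c.length, basisVector c b i (μ i)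

theorem rowSum_congr {μ' : ℕ → ℤ} (h : ∀ i, μ i = μ' i ∨ μ i ≤ 0 ∧ μ' i ≤ 0) :
    rowSum c b μ = rowSum c b μ' := by
  refine Finset.sum_congr rfl fun i _ => ?_
  rcases h i with h | h
  · rw [h]
  · rw [basisVector_of_nonpos h.1, basisVector_of_nonpos h.2]

theorem rowSum_eq_zero (h : ∀ i, μ i ≤ 0) : rowSum c b μ = 0 :=
  Finset.sum_eq_zero fun i _ => basisVector_of_nonpos (h i)

theorem map_rowSum_of_forall_ne {W : Type*} [AddCommGroup W] [Module F W] (f : V →ₗ[F] W) {s : ℕ}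
    (hf : ∀ i ≠ s, ∀ k, f (basisVector c b i k) = 0) :
    f (rowSum c b μ) = f (basisVector c b s (μ s)) := by
  rw [rowSum, map_sum]
  refine Finset.sum_eq_single s (fun i _ hi => hf i hi _) fun hs => ?_
  rw [Finset.mem_range, ← c.len_pos_iff] at hs
  rw [basisVector, dif_neg (by omega), map_zero]

theorem basisCoord_rowSum (i : ℕ) (k : ℤ) :
    basisCoord c b i k (rowSum c b μ) = basisCoord c b i k (basisVector c b i (μ i)) := by
  refine map_rowSum_of_forall_ne _ fun j hj l => ?_
  by_cases hl : 0 < l ∧ l ≤ c.len j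
  · rw [basisCoord_basisVector hl.1 hl.2, if_neg fun h => hj h.1.symm]
  · rw [basisVector, dif_neg hl, map_zero]

theorem basisCoord_rowSum_self {i : ℕ} (h0 : 0 < μ i) (hμ : μ i ≤ c.len i) :
    basisCoord c b i (μ i) (rowSum c b μ) = 1 := by
  rw [basisCoord_rowSum, basisCoord_basisVector h0 hμ, if_pos ⟨rfl, rfl⟩]

theorem rowTransfer_rowSum {s : ℕ} {u : V} (hu : (x ^ c.len s) u = 0) (hμ : μ s ≤ c.len s) :
    rowTransfer c b x s u (rowSum c b μ) = (x ^ ((c.len s : ℤ) - μ s).toNat) u := by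
  rw [map_rowSum_of_forall_ne _ fun i hi k => rowTransfer_basisVector_of_ne hi k,
    rowTransfer_basisVector_self hu hμ]

theorem IsColoredJordanBasis.rowSum_mem (hb : IsColoredJordanBasis C x c b) {m : ZMod n}
    (hμ : ∀ i, 0 < μ i → c.columnColor i (μ i) = m) : rowSum c b μ ∈ C m := by
  refine Submodule.sum_mem _ fun i _ => ?_
  rcases lt_or_ge 0 (μ i) with h | h
  · exact hμ i h ▸ hb.basisVector_mem i (μ i)
  · rw [basisVector_of_nonpos h]
    exact Submodule.zero_mem _

end RowSum

section Marks

variable {F : Type*} [Field F] {V : Type*} [AddCommGroup V] [Module F V] {n : ℕ}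
  {C : ZMod n → Submodule F V} {x : Module.End F V} {P Q : MarkedColoredPartition n}
  {b : Module.Basis P.Box F V} {d : Module.Basis Q.Box F V}

theorem markedVector_eq_zero_iff : markedVector P b = 0 ↔ ∀ i, P.mark i ≤ 0 := by
  refine ⟨fun h i => ?_, rowSum_eq_zero⟩
  by_contra! hi
  have hcoord : basisCoord P.toColoredPartition b i (P.mark i) (markedVector P b) = 1 :=
    basisCoord_rowSum_self hi (P.mark_le i)
  rw [h, map_zero] at hcoord
  exact zero_ne_one hcoord

theorem MarkedColoredPartition.IsColoredQuasiBipartition.lt_mark_add [NeZero n]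
    (hP : P.IsColoredQuasiBipartition) {i j : ℕ} {k : ℤ} (hk : k ≤ P.mark j)
    (hk' : k + P.nu j ≤ P.len i) : k < P.mark i + n := by
  have hn := NeZero.pos n
  rcases lt_trichotomy i j with hij | rfl | hij
  · exact hk.trans_lt (hP.2.1 i j hij).1
  · omega
  · have := (hP.2.1 j i hij).2
    simp only [nu] at this hk'
    omega

theorem mark_le_of_markedVector_eq [NeZero n] (hC : DirectSum.IsInternal C)
    (hb : IsColoredJordanBasis C x P.toColoredPartition b)
    (hd : IsColoredJordanBasis C x Q.toColoredPartition d)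
    (hP : P.IsColoredQuasiBipartition) (hv : markedVector P b = markedVector Q d) {i i' : ℕ}
    (hlen : Q.len i' = P.len i) (hcolor : Q.color i' = P.color i)
    (hmod : (Q.mark i' : ZMod n) = P.mark i) (hpos : 0 < Q.mark i') :
    Q.mark i' ≤ P.mark i := by
  have hle := Q.mark_le i'
  let u := basisVector P.toColoredPartition b i (P.len i)
  let T := rowTransfer Q.toColoredPartition d x i' u
  have hu : (x ^ Q.len i') u = 0 := by
    rw [hb.pow_apply_basisVector le_rfl, basisVector_of_nonpos (by omega)]
  have hT : T ∈ coloredCentralizer C x := by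
    refine hd.rowTransfer_mem hC hu ?_
    have := hb.basisVector_mem i (P.len i)
    rwa [ColoredPartition.columnColor, sub_self, Int.cast_zero, add_zero, ← hcolor] at this
  have hTv : T (markedVector P b) = basisVector P.toColoredPartition b i (Q.mark i') := by
    rw [hv]
    refine (rowTransfer_rowSum hu hle).trans ?_
    rw [hb.pow_apply_basisVector le_rfl]
    congr 1
    omega
  have hcoord : basisCoord P.toColoredPartition b i (Q.mark i') (T (markedVector P b)) ≠ 0 := by
    rw [hTv, basisCoord_basisVector hpos (by omega), if_pos ⟨rfl, rfl⟩]
    exact one_ne_zero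
  rw [markedVector, map_sum, map_sum] at hcoord
  obtain ⟨j, -, hj⟩ := Finset.exists_ne_zero_of_sum_ne_zero hcoord
  obtain ⟨hk, hk'⟩ := hb.le_and_add_le_of_commute hT.1 (P.mark_le j) hj
  exact le_of_lt_add_of_intCast_eq (hP.lt_mark_add hk hk') hmod

theorem markColor_eq_of_markedVector_eq (hC : DirectSum.IsInternal C)
    (hb : IsColoredJordanBasis C x P.toColoredPartition b)
    (hd : IsColoredJordanBasis C x Q.toColoredPartition d)
    (hP : ∀ i j, P.markColor i = P.markColor j) (hQ : ∀ i j, Q.markColor i = Q.markColor j)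
    (hv : markedVector P b = markedVector Q d) (h0 : markedVector P b ≠ 0) (i j : ℕ) :
    P.markColor i = Q.markColor j := by
  obtain ⟨i₀, hi₀⟩ : ∃ i, 0 < P.mark i := by simpa [markedVector_eq_zero_iff] using h0
  have hmem : markedVector P b ∈ C (Q.markColor j) :=
    hv ▸ hd.rowSum_mem fun k _ => hQ k j
  rw [hP i i₀]
  refine hb.columnColor_eq_of_basisCoord_ne_zero hC hmem ?_
  have hcoord : basisCoord P.toColoredPartition b i₀ (P.mark i₀) (markedVector P b) = 1 :=
    basisCoord_rowSum_self hi₀ (P.mark_le i₀)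
  exact hcoord ▸ one_ne_zero

theorem rowEquiv_of_markedVector_eq [NeZero n] (hC : DirectSum.IsInternal C)
    (hb : IsColoredJordanBasis C x P.toColoredPartition b)
    (hd : IsColoredJordanBasis C x Q.toColoredPartition d)
    (hP : P.IsColoredQuasiBipartition) (hQ : Q.IsColoredQuasiBipartition)
    (hv : markedVector P b = markedVector Q d) (h0 : markedVector P b ≠ 0) : P.RowEquiv Q := by
  obtain ⟨σ, hσ⟩ := HasColoredJordanType.rowEquiv hC ⟨b, hb⟩ ⟨d, hd⟩
  refine ⟨σ, fun i => ⟨(hσ i).1, (hσ i).2, ?_⟩⟩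
  have hmod : (Q.mark i : ZMod n) = P.mark (σ i) := by
    have hcolor : P.columnColor (σ i) (P.mark (σ i)) = Q.columnColor i (Q.mark i) :=
      markColor_eq_of_markedVector_eq hC hb hd hP.2.2 hQ.2.2 hv h0 (σ i) i
    rw [ColoredPartition.columnColor_congr (hσ i).1 (hσ i).2] at hcolor
    exact ((P.columnColor_eq_columnColor_iff _ _ _).1 hcolor).symm
  have hle : 0 < Q.mark i → Q.mark i ≤ P.mark (σ i) :=
    mark_le_of_markedVector_eq hC hb hd hP hv (hσ i).1 (hσ i).2 hmod
  have hge : 0 < P.mark (σ i) → P.mark (σ i) ≤ Q.mark i :=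
    mark_le_of_markedVector_eq hC hd hb hQ hv.symm (hσ i).1.symm (hσ i).2.symm hmod.symm
  have hPn := hP.1 (σ i)
  have hQn := hQ.1 i
  by_cases h : 0 < Q.mark i ∨ 0 < P.mark (σ i)
  · omega
  · exact le_antisymm (le_of_lt_add_of_intCast_eq (by omega) hmod)
      (le_of_lt_add_of_intCast_eq (by omega) hmod.symm)

end Marks

/-! ### Generalized quasi-bipartitions -/

/-- The marked colored partition `(λ, ε, μ)`, where `c = (λ, ε)`. -/
def ColoredPartition.withMark {n : ℕ} (c : ColoredPartition n) (μ : ℕ → ℤ)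
    (hμ : ∀ i, μ i ≤ c.len i) : MarkedColoredPartition n :=
  { c with mark := μ, mark_le := hμ }

theorem ColoredPartition.exists_rows_of_not_isGeneralizedQuasiBipartition {n : ℕ}
    {c : ColoredPartition n} {μ : ℕ → ℤ} {hμ : ∀ i, μ i ≤ c.len i} (hn : ∀ i, -(n : ℤ) < μ i)
    (h : ¬ (c.withMark μ hμ).IsGeneralizedQuasiBipartition) :
    ∃ r s, r ≠ s ∧ c.columnColor r (μ r) = c.columnColor s (μ s) ∧
      μ r + n ≤ μ s ∧ μ r + n + (c.len s - μ s) ≤ c.len r := by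
  by_contra! hne
  refine h ⟨hn, fun i j hij hcolor => ?_⟩
  have hlen := c.len_antitone hij.le
  change μ j < μ i + n ∧ (c.len j : ℤ) - μ j < c.len i - μ i + n
  constructor
  · by_contra! hmark
    have := hne i j hij.ne hcolor hmark
    omega
  · by_contra! hnu
    have := hne j i hij.ne' hcolor.symm (by omega)
    omega

section Raising

variable {F : Type*} [Field F] {V : Type*} [AddCommGroup V] [Module F V] {n : ℕ}
  {C : ZMod n → Submodule F V} {c : ColoredPartition n} {b : Module.Basis c.Box F V}
  {μ : ℕ → ℤ}

theorem rowSum_update {r : ℕ} (hr : 0 < c.len r) (k : ℤ) :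
    rowSum c b (Function.update μ r k) =
      rowSum c b μ + (basisVector c b r k - basisVector c b r (μ r)) := by
  have hmem : r ∈ Finset.range c.length := Finset.mem_range.2 ((c.len_pos_iff r).1 hr)
  have herase : ∀ i ∈ (Finset.range c.length).erase r,
      basisVector c b i (Function.update μ r k i) = basisVector c b i (μ i) := fun i hi => by
    rw [Function.update_of_ne (Finset.ne_of_mem_erase hi)]
  rw [rowSum, rowSum, ← Finset.add_sum_erase _ _ hmem, ← Finset.add_sum_erase _ _ hmem,
    Function.update_self, Finset.sum_congr rfl herase]
  abel

theorem rowTransfer_mul_self {x : Module.End F V} {s : ℕ} {u : V} (hu : (x ^ c.len s) u = 0)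
    (hcomm : Commute (rowTransfer c b x s u) x) (h : rowTransfer c b x s u u = 0) :
    rowTransfer c b x s u * rowTransfer c b x s u = 0 := by
  refine linearMap_ext_basisVector b fun i k _ hk => ?_
  rw [Module.End.mul_apply, LinearMap.zero_apply]
  rcases eq_or_ne i s with rfl | hi
  · rw [rowTransfer_basisVector_self hu hk, ← Module.End.mul_apply, (hcomm.pow_right _).eq,
      Module.End.mul_apply, h, map_zero]
  · rw [rowTransfer_basisVector_of_ne hi, map_zero]

theorem orbitOf_rowSum_update_add [FiniteDimensional F V] (hC : DirectSum.IsInternal C)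
    {x : NilCone C} (hb : IsColoredJordanBasis C x.1 c b) {r s : ℕ} (hs : μ s ≤ c.len s)
    (hr : 0 < c.len r) (hrs : r ≠ s) (hcolor : c.columnColor r (μ r) = c.columnColor s (μ s))
    (hmark : μ r + n ≤ μ s) (hnu : μ r + n + (c.len s - μ s) ≤ c.len r) :
    orbitOf C (rowSum c b (Function.update μ r (μ r + n))) x = orbitOf C (rowSum c b μ) x := by
  let ν : ℤ := c.len s - μ s
  let u : V := basisVector c b r (μ r + n + ν) - basisVector c b r (μ r + ν)
  have hpow (t : ℕ) : (x.1 ^ t) u =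
      basisVector c b r (μ r + n + ν - t) - basisVector c b r (μ r + ν - t) := by
    rw [map_sub, hb.pow_apply_basisVector hnu, hb.pow_apply_basisVector (by omega)]
  have hu : (x.1 ^ c.len s) u = 0 := by
    rw [hpow, basisVector_of_nonpos (by omega), basisVector_of_nonpos (by omega), sub_zero]
  have hcolor_u : u ∈ C (c.color s) := by
    have hcolor_r : c.columnColor r (μ r + ν) = c.color s := by
      rw [c.columnColor_add, hcolor, ColoredPartition.columnColor, add_sub_cancel_right]
    refine Submodule.sub_mem _ ?_ (hcolor_r ▸ hb.basisVector_mem r _)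
    rw [← hcolor_r, (c.columnColor_eq_columnColor_iff r _ (μ r + n + ν)).2 (by simp)]
    exact hb.basisVector_mem r _
  have hT := hb.rowTransfer_mem hC hu hcolor_u
  have hTu : rowTransfer c b x.1 s u u = 0 := by
    rw [map_sub, rowTransfer_basisVector_of_ne hrs, rowTransfer_basisVector_of_ne hrs, sub_zero]
  have hnil : IsNilpotent (rowTransfer c b x.1 s u) :=
    ⟨2, by rw [pow_two, rowTransfer_mul_self hu hT.1 hTu]⟩
  rw [← orbitOf_add_apply_eq hT hnil (rowSum c b μ), rowTransfer_rowSum hu hs, hpow,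
    rowSum_update hr]
  congr 4 <;> omega

theorem exists_isGeneralizedQuasiBipartition_of_neg_lt [FiniteDimensional F V] [NeZero n]
    (hC : DirectSum.IsInternal C) {x : NilCone C} (hb : IsColoredJordanBasis C x.1 c b)
    (hμ : ∀ i, μ i ≤ c.len i) (hn : ∀ i, -(n : ℤ) < μ i) :
    ∃ (μ' : ℕ → ℤ) (hμ' : ∀ i, μ' i ≤ c.len i),
      (c.withMark μ' hμ').IsGeneralizedQuasiBipartition ∧
      (∀ i, (μ' i : ZMod n) = μ i) ∧
      orbitOf C (rowSum c b μ') x = orbitOf C (rowSum c b μ) x := by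
  induction hN : ∑ i ∈ Finset.range c.length, ((c.len i : ℤ) - μ i).toNat
    using Nat.strong_induction_on generalizing μ with
  | _ N ih =>
  by_cases hgen : (c.withMark μ hμ).IsGeneralizedQuasiBipartition
  · exact ⟨μ, hμ, hgen, fun _ => rfl, rfl⟩
  obtain ⟨r, s, hrs, hcolor, hmark, hnu⟩ :=
    ColoredPartition.exists_rows_of_not_isGeneralizedQuasiBipartition hn hgen
  have hs := hμ s
  have hr := hn r
  have hlen : 0 < c.len r := by omega
  have hpos := NeZero.pos n
  let μ₁ := Function.update μ r (μ r + n)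
  have hμ₁ : ∀ i, μ₁ i ≤ c.len i :=
    (Function.forall_update_iff μ fun i k => k ≤ c.len i).2 ⟨by omega, fun i _ => hμ i⟩
  have hn₁ : ∀ i, -(n : ℤ) < μ₁ i :=
    (Function.forall_update_iff μ fun _ k => -(n : ℤ) < k).2 ⟨by omega, fun i _ => hn i⟩
  have hmod₁ : ∀ i, (μ₁ i : ZMod n) = μ i :=
    (Function.forall_update_iff μ fun i k => (k : ZMod n) = μ i).2 ⟨by simp, fun _ _ => rfl⟩
  have hle₁ : ∀ i, μ i ≤ μ₁ i :=
    (Function.forall_update_iff μ fun i k => μ i ≤ k).2 ⟨by omega, fun _ _ => le_rfl⟩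
  have hlt : ∑ i ∈ Finset.range c.length, ((c.len i : ℤ) - μ₁ i).toNat < N := by
    rw [← hN]
    refine Finset.sum_lt_sum (fun i _ => Int.toNat_le_toNat (sub_le_sub_left (hle₁ i) _))
      ⟨r, Finset.mem_range.2 ((c.len_pos_iff r).1 hlen), ?_⟩
    have hr₁ : μ₁ r = μ r + n := Function.update_self ..
    omega
  obtain ⟨μ', hμ', hgen', hmod', horbit⟩ := ih _ hlt hμ₁ hn₁ rfl
  exact ⟨μ', hμ', hgen', fun i => (hmod' i).trans (hmod₁ i),
    horbit.trans (orbitOf_rowSum_update_add hC hb hs hlen hrs hcolor hmark hnu)⟩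

theorem exists_isGeneralizedQuasiBipartition [FiniteDimensional F V] [NeZero n]
    (hC : DirectSum.IsInternal C) {x : NilCone C} (hb : IsColoredJordanBasis C x.1 c b)
    (hμ : ∀ i, μ i ≤ c.len i) :
    ∃ (μ' : ℕ → ℤ) (hμ' : ∀ i, μ' i ≤ c.len i),
      (c.withMark μ' hμ').IsGeneralizedQuasiBipartition ∧
      (∀ i, (μ' i : ZMod n) = μ i) ∧
      orbitOf C (rowSum c b μ') x = orbitOf C (rowSum c b μ) x := by
  have hn : (0 : ℤ) < n := by exact_mod_cast NeZero.pos n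
  let μ₀ : ℕ → ℤ := fun i => if 0 < μ i then μ i else -(-μ i % n)
  have hsame : ∀ i, μ₀ i = μ i ∨ μ₀ i ≤ 0 ∧ μ i ≤ 0 := by
    intro i
    have := Int.emod_nonneg (-μ i) hn.ne'
    simp only [μ₀]
    split_ifs <;> omega
  have hneg : ∀ i, -(n : ℤ) < μ₀ i := by
    intro i
    have := Int.emod_lt_of_pos (-μ i) hn
    simp only [μ₀]
    split_ifs <;> omega
  have hmod : ∀ i, (μ₀ i : ZMod n) = μ i := by
    intro i
    simp only [μ₀]
    split_ifs
    · rfl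
    · rw [Int.cast_neg, ZMod.intCast_mod, Int.cast_neg, neg_neg]
  have hle : ∀ i, μ₀ i ≤ c.len i := by
    intro i
    have := hμ i
    have := hsame i
    omega
  obtain ⟨μ', hμ', hgen, hmod', horbit⟩ :=
    exists_isGeneralizedQuasiBipartition_of_neg_lt hC hb hle hneg
  exact ⟨μ', hμ', hgen, fun i => (hmod' i).trans (hmod i), by rw [horbit, rowSum_congr hsame]⟩

end Raising

/-! ### Orbits of colored vectors -/

section ColoredVector

variable {F : Type*} [Field F] {V : Type*} [AddCommGroup V] [Module F V] {n : ℕ}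
  {C : ZMod n → Submodule F V} {c : ColoredPartition n} {b : Module.Basis c.Box F V}
  {x : Module.End F V}

/-- The component of `v` in row `i`, moved to the right by `t` columns. -/
noncomputable def rowPart (c : ColoredPartition n) (b : Module.Basis c.Box F V) (i : ℕ) (t : ℤ)
    (v : V) : V :=
  ∑ l ∈ Finset.Icc (1 : ℤ) (c.len i), basisCoord c b i l v • basisVector c b i (l + t)

theorem sum_rowPart_zero (b : Module.Basis c.Box F V) (v : V) :
    ∑ i ∈ Finset.range c.length, rowPart c b i 0 v = v := by
  suffices ∑ i ∈ Finset.range c.length, ∑ l ∈ Finset.Icc (1 : ℤ) (c.len i),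
      (basisCoord c b i l).smulRight (basisVector c b i l) = LinearMap.id by
    simpa [rowPart] using LinearMap.congr_fun this v
  refine linearMap_ext_basisVector b fun i k h0 hk => ?_
  have hi : i ∈ Finset.range c.length := by
    rw [Finset.mem_range, ← c.len_pos_iff]
    omega
  have hk' : k ∈ Finset.Icc (1 : ℤ) (c.len i) := Finset.mem_Icc.2 ⟨by omega, hk⟩
  simp only [LinearMap.sum_apply, LinearMap.smulRight_apply, basisCoord_basisVector h0 hk,
    LinearMap.id_apply]
  rw [Finset.sum_eq_single_of_mem i hi fun i' _ hi' => Finset.sum_eq_zero fun l _ => by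
      rw [if_neg fun h => hi' h.1, zero_smul],
    Finset.sum_eq_single_of_mem k hk' fun l _ hl => by
      rw [if_neg fun h => hl h.2, zero_smul], if_pos ⟨rfl, rfl⟩, one_smul]

section Bound

variable {i : ℕ} {k : ℤ} {v : V}

theorem rowPart_neg_eq_zero (hk : ∀ l, basisCoord c b i l v ≠ 0 → l ≤ k) :
    rowPart c b i (-k) v = 0 := by
  refine Finset.sum_eq_zero fun l _ => ?_
  by_cases hl : basisCoord c b i l v = 0
  · rw [hl, zero_smul]
  · have := hk l hl
    rw [basisVector_of_nonpos (by omega), smul_zero]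

theorem rowPart_one_sub (hk : ∀ l, basisCoord c b i l v ≠ 0 → l ≤ k) :
    rowPart c b i (1 - k) v = basisCoord c b i k v • basisVector c b i 1 := by
  refine (Finset.sum_eq_single k (fun l _ hlk => ?_) fun hk' => ?_).trans (by rw [add_sub_cancel])
  · by_cases hl : basisCoord c b i l v = 0
    · rw [hl, zero_smul]
    · have := hk l hl
      rw [basisVector_of_nonpos (by omega), smul_zero]
  · rw [basisCoord_eq_zero fun h => hk' (Finset.mem_Icc.2 ⟨by omega, h.2⟩),
      LinearMap.zero_apply, zero_smul]

theorem IsColoredJordanBasis.pow_apply_rowPart (hb : IsColoredJordanBasis C x c b) {t : ℤ}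
    (ht : ∀ l, basisCoord c b i l v ≠ 0 → l + t ≤ c.len i) (s : ℕ) :
    (x ^ s) (rowPart c b i t v) = rowPart c b i (t - s) v := by
  rw [rowPart, map_sum]
  refine Finset.sum_congr rfl fun l _ => ?_
  rw [map_smul]
  by_cases hl : basisCoord c b i l v = 0
  · rw [hl, zero_smul, zero_smul]
  · rw [hb.pow_apply_basisVector (ht l hl), add_sub_assoc]

end Bound

namespace IsColoredJordanBasis

theorem rowPart_mem (hC : DirectSum.IsInternal C) (hb : IsColoredJordanBasis C x c b) {m : ZMod n}
    {v : V} (hv : v ∈ C m) (i : ℕ) (t : ℤ) : rowPart c b i t v ∈ C (m - t) := by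
  refine Submodule.sum_mem _ fun l _ => ?_
  by_cases hl : basisCoord c b i l v = 0
  · rw [hl, zero_smul]
    exact Submodule.zero_mem _
  · refine Submodule.smul_mem _ _ ?_
    rw [← hb.columnColor_eq_of_basisCoord_ne_zero hC hv hl, ← c.columnColor_add]
    exact hb.basisVector_mem i _

theorem exists_row_generator [NeZero n] (hC : DirectSum.IsInternal C)
    (hb : IsColoredJordanBasis C x c b) {m : ZMod n} {v : V} (hv : v ∈ C m) (i : ℕ) :
    ∃ (k : ℤ) (w : V) (a : F), k ≤ c.len i ∧ c.columnColor i k = m ∧ w ∈ C (c.color i) ∧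
      (x ^ c.len i) w = 0 ∧ a ≠ 0 ∧ (x ^ (c.len i - 1)) w = a • basisVector c b i 1 ∧
      (x ^ ((c.len i : ℤ) - k).toNat) w = rowPart c b i 0 v := by
  by_cases hex : ∃ l, basisCoord c b i l v ≠ 0
  · obtain ⟨k, hk, hmax⟩ := Int.exists_greatest_of_bdd
      ⟨c.len i, fun l hl => (mem_column_of_basisCoord_ne_zero hl).2⟩ hex
    obtain ⟨h0, hle⟩ := mem_column_of_basisCoord_ne_zero hk
    have hcolor := hb.columnColor_eq_of_basisCoord_ne_zero hC hv hk
    have hpow := hb.pow_apply_rowPart (t := c.len i - k) fun l hl => by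
      have := hmax l hl
      omega
    refine ⟨k, rowPart c b i (c.len i - k) v, basisCoord c b i k v, hle, hcolor, ?_, ?_, hk, ?_, ?_⟩
    · convert hb.rowPart_mem hC hv i (c.len i - k) using 2
      rw [← hcolor, ColoredPartition.columnColor, add_sub_cancel_right]
    · rw [hpow, sub_sub_cancel_left, rowPart_neg_eq_zero hmax]
    · rw [hpow, ← rowPart_one_sub hmax]
      congr 1
      omega
    · rw [hpow]
      congr 1
      omega
  · push Not at hex
    obtain ⟨k, hk0, hk⟩ := MarkedColoredPartition.rhoCandidates_nonempty m c.zeroMarking i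
    change k ≤ 0 at hk0
    refine ⟨k, basisVector c b i (c.len i), 1, by omega, hk, ?_, ?_, one_ne_zero, ?_, ?_⟩
    · simpa [ColoredPartition.columnColor] using hb.basisVector_mem i (c.len i)
    · rw [hb.pow_apply_basisVector le_rfl, sub_self, basisVector_of_nonpos le_rfl]
    · rw [hb.pow_apply_basisVector le_rfl, one_smul]
      rcases Nat.eq_zero_or_pos (c.len i) with h | h
      · rw [basisVector_of_nonpos (by omega), basisVector, dif_neg (by omega)]
      · congr 1
        omega
    · rw [hb.pow_apply_basisVector le_rfl, basisVector_of_nonpos (by omega), rowPart]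
      simp only [hex, zero_smul, Finset.sum_const_zero]

theorem injective_of_apply_first (hb : IsColoredJordanBasis C x c b) (hx : IsNilpotent x)
    {T : Module.End F V} (hTx : Commute T x) {a : ℕ → F} (ha : ∀ i, a i ≠ 0)
    (hT : ∀ i, 0 < c.len i → T (basisVector c b i 1) = a i • basisVector c b i 1) :
    Function.Injective T := by
  refine injective_of_commute_of_ker_inf_ker_eq_bot hTx hx ((Submodule.eq_bot_iff _).2 ?_)
  rintro u ⟨hxu, hTu⟩
  have hcoord (i : ℕ) : basisCoord c b i 1 (T u) = a i * basisCoord c b i 1 u := by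
    rw [hb.ker_eq_span] at hxu
    refine LinearMap.eqOn_span (f := basisCoord c b i 1 ∘ₗ T) (g := a i • basisCoord c b i 1)
      ?_ hxu
    rintro _ ⟨⟨j, l, hl⟩, hl0, rfl⟩
    obtain rfl : l = 0 := hl0
    have hfirst : basisVector c b j 1 = b ⟨j, ⟨0, hl⟩⟩ := by
      simpa using basisVector_add_one (b := b) j 0 hl
    rw [LinearMap.comp_apply, ← hfirst, hT j hl, map_smul, LinearMap.smul_apply,
      basisCoord_basisVector one_pos (by omega)]
    by_cases hij : i = j
    · rw [hij]
    · rw [if_neg fun h => hij h.1, smul_zero, smul_zero]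
  refine eq_zero_of_basisCoord_eq_zero (b := b) fun i k => ?_
  by_contra hk
  obtain rfl := hb.eq_one_of_basisCoord_ne_zero hxu hk
  refine mul_ne_zero (ha i) hk ?_
  rw [← hcoord, LinearMap.mem_ker.1 hTu, map_zero]

theorem exists_orbitOf_rowSum_eq [FiniteDimensional F V] [NeZero n] (hC : DirectSum.IsInternal C)
    {x : NilCone C} (hb : IsColoredJordanBasis C x.1 c b) {m : ZMod n} {v : V} (hv : v ∈ C m) :
    ∃ μ : ℕ → ℤ, (∀ i, μ i ≤ c.len i) ∧ (∀ i, c.columnColor i (μ i) = m) ∧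
      orbitOf C (rowSum c b μ) x = orbitOf C v x := by
  choose μ w a hμ hcolor hw hw0 ha hw1 hwv using hb.exists_row_generator hC hv
  let T := rowExtension c b x.1 w
  have hT : T ∈ coloredCentralizer C x.1 := hb.rowExtension_mem hC hw0 hw
  have hfirst : ∀ i, 0 < c.len i → T (basisVector c b i 1) = a i • basisVector c b i 1 := by
    intro i hi
    rw [← hw1, rowExtension_basisVector (hw0 i) (by omega)]
    congr 2
    omega
  have hTv : T (rowSum c b μ) = v := by
    rw [rowSum, map_sum, ← sum_rowPart_zero b v]
    refine Finset.sum_congr rfl fun i _ => ?_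
    rw [rowExtension_basisVector (hw0 i) (hμ i), hwv]
  refine ⟨μ, hμ, hcolor, ?_⟩
  rw [← hTv, orbitOf_apply_eq hT (hb.injective_of_apply_first x.2.1 hT.1 ha hfirst)]

end IsColoredJordanBasis

end ColoredVector

/-! ### Existence of colored Jordan bases -/

namespace ColoredPartition

variable {n : ℕ}

/-- The colored partition with no boxes; its rows, all of length zero, are colored cyclically. -/
def empty (n : ℕ) [NeZero n] : ColoredPartition n where
  len _ := 0
  color i := i
  len_antitone := antitone_const
  exists_len_eq_zero := ⟨0, rfl⟩
  infinite_color m := by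
    refine Set.infinite_of_injective_forall_mem (f := fun t : ℕ => m.val + n * t) ?_ fun t => ?_
    · exact fun s t h => Nat.eq_of_mul_eq_mul_left (NeZero.pos n) (Nat.add_left_cancel h)
    · simp

/-- The colored partition obtained from `c` by adding a row of length `l` and color `e` on top. -/
def cons (c : ColoredPartition n) (l : ℕ) (e : ZMod n) (h : c.len 0 ≤ l) : ColoredPartition n where
  len i := i.casesOn l c.len
  color i := i.casesOn e c.color
  len_antitone := antitone_nat_of_succ_le fun i => match i with
    | 0 => h
    | i + 1 => c.len_antitone i.le_succ
  exists_len_eq_zero := c.exists_len_eq_zero.imp' Nat.succ fun _ => id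
  infinite_color m := ((c.infinite_color m).image Nat.succ_injective.injOn).mono <| by
    rintro _ ⟨i, hi, rfl⟩
    exact hi

/-- The boxes of `c.cons l e h` are those of the new row and those of `c`. -/
def consBoxEquiv (c : ColoredPartition n) (l : ℕ) (e : ZMod n) (h : c.len 0 ≤ l) :
    (c.cons l e h).Box ≃ Fin l ⊕ c.Box where
  toFun
    | ⟨0, j⟩ => .inl j
    | ⟨i + 1, j⟩ => .inr ⟨i, j⟩
  invFun
    | .inl j => ⟨0, j⟩
    | .inr p => ⟨p.1 + 1, p.2⟩
  left_inv
    | ⟨0, _⟩ => rfl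
    | ⟨_ + 1, _⟩ => rfl
  right_inv
    | .inl _ => rfl
    | .inr _ => rfl

end ColoredPartition

section InvariantCore

variable {F : Type*} [Field F] {V : Type*} [AddCommGroup V] [Module F V] {x : Module.End F V}
  {φ : Module.Dual F V}

/-- The largest `x`-stable subspace of the kernel of `φ`. -/
def invariantCore (φ : Module.Dual F V) (x : Module.End F V) : Submodule F V :=
  ⨅ j : ℕ, LinearMap.ker (φ ∘ₗ x ^ j)

theorem mem_invariantCore {u : V} : u ∈ invariantCore φ x ↔ ∀ j : ℕ, φ ((x ^ j) u) = 0 := by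
  simp [invariantCore]

theorem apply_mem_invariantCore {u : V} (hu : u ∈ invariantCore φ x) :
    x u ∈ invariantCore φ x := by
  rw [mem_invariantCore] at hu ⊢
  intro j
  rw [← Module.End.mul_apply, ← pow_succ, hu]

/-- The linear map that sends the standard basis to `x ^ d v, …, x v, v`. -/
noncomputable def stringMap (x : Module.End F V) (v : V) (d : ℕ) : (Fin (d + 1) → F) →ₗ[F] V :=
  Fintype.linearCombination F fun i => (x ^ (d - i)) v

variable {v : V} {d : ℕ}

theorem eq_zero_of_stringMap_mem_invariantCore (hx : x ^ (d + 1) = 0) (hφ : φ ((x ^ d) v) ≠ 0)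
    {a : Fin (d + 1) → F} (ha : stringMap x v d a ∈ invariantCore φ x) : a = 0 := by
  classical
  by_contra hne
  obtain ⟨i, hi, hmax⟩ := Finset.exists_max_image (Finset.univ.filter fun i => a i ≠ 0) id <| by
    simpa [Finset.filter_nonempty_iff] using Function.ne_iff.1 hne
  simp only [Finset.mem_filter, Finset.mem_univ, true_and, id] at hi hmax
  have hsum := mem_invariantCore.1 ha i
  rw [stringMap, Fintype.linearCombination_apply, map_sum, map_sum,
    Finset.sum_eq_single i (fun k _ hki => ?_) fun h => (h (Finset.mem_univ i)).elim] at hsum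
  · rw [map_smul, map_smul, ← Module.End.mul_apply, ← pow_add, Nat.add_sub_cancel' (by omega)]
      at hsum
    exact mul_ne_zero hi hφ hsum
  · rw [map_smul, ← Module.End.mul_apply, ← pow_add]
    by_cases hk : a k = 0
    · rw [hk, zero_smul, map_zero]
    · have := lt_of_le_of_ne (hmax k hk) hki
      rw [pow_eq_zero_of_le (by omega) hx, LinearMap.zero_apply, smul_zero, map_zero]

theorem bijective_coprod_stringMap (hx : x ^ (d + 1) = 0) (hφ : φ ((x ^ d) v) ≠ 0) :
    Function.Bijective ((stringMap x v d).coprod (invariantCore φ x).subtype) := by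
  let θ : V →ₗ[F] Fin (d + 1) → F := LinearMap.pi fun j => φ ∘ₗ x ^ (j : ℕ)
  have hθ (u : V) (hu : θ u = 0) : u ∈ invariantCore φ x := by
    refine mem_invariantCore.2 fun j => ?_
    rcases lt_or_ge j (d + 1) with hj | hj
    · exact congrFun hu ⟨j, hj⟩
    · rw [pow_eq_zero_of_le hj hx, LinearMap.zero_apply, map_zero]
  have hinj : Function.Injective (θ ∘ₗ stringMap x v d) :=
    (injective_iff_map_eq_zero _).2 fun a ha =>
      eq_zero_of_stringMap_mem_invariantCore hx hφ (hθ _ ha)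
  constructor
  · refine (injective_iff_map_eq_zero _).2 ?_
    rintro ⟨a, w⟩ h
    rw [LinearMap.coprod_apply, Submodule.subtype_apply] at h
    obtain rfl : a = 0 := eq_zero_of_stringMap_mem_invariantCore hx hφ <| by
      rw [eq_neg_of_add_eq_zero_left h]
      exact neg_mem w.2
    rw [map_zero, zero_add] at h
    exact Prod.ext rfl (Subtype.ext h)
  · intro u
    obtain ⟨a, ha⟩ := LinearMap.injective_iff_surjective.1 hinj (θ u)
    refine ⟨(a, ⟨u - stringMap x v d a, hθ _ ?_⟩), ?_⟩
    · rw [map_sub, ← ha, LinearMap.comp_apply, sub_self]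
    · rw [LinearMap.coprod_apply, Submodule.subtype_apply, add_sub_cancel]

/-- Adding the string `x ^ d v, …, x v, v` to a basis of the invariant core. -/
noncomputable def stringBasis {ι : Type*} (hx : x ^ (d + 1) = 0) (hφ : φ ((x ^ d) v) ≠ 0)
    (b : Module.Basis ι F (invariantCore φ x)) : Module.Basis (Fin (d + 1) ⊕ ι) F V :=
  ((Pi.basisFun F (Fin (d + 1))).prod b).map
    (LinearEquiv.ofBijective _ (bijective_coprod_stringMap hx hφ))

section StringBasis

variable {ι : Type*} (hx : x ^ (d + 1) = 0) (hφ : φ ((x ^ d) v) ≠ 0)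
  (b : Module.Basis ι F (invariantCore φ x))

theorem stringBasis_inl (i : Fin (d + 1)) : stringBasis hx hφ b (.inl i) = (x ^ (d - i)) v := by
  simp [stringBasis, stringMap]

theorem stringBasis_inr (p : ι) : stringBasis hx hφ b (.inr p) = b p := by
  simp [stringBasis]

end StringBasis

end InvariantCore

section Homogeneous

variable {F : Type*} [Field F] {V : Type*} [AddCommGroup V] [Module F V]

theorem isInternal_comap_subtype {ι : Type*} [DecidableEq ι] {C : ι → Submodule F V}
    (hC : DirectSum.IsInternal C) {W : Submodule F V}
    (hW : W ≤ ⨆ m, C m ⊓ W) : DirectSum.IsInternal fun m => (C m).comap W.subtype := by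
  have hmap (m : ι) : ((C m).comap W.subtype).map W.subtype = C m ⊓ W := by
    rw [Submodule.map_comap_subtype, inf_comm]
  refine DirectSum.isInternal_submodule_of_iSupIndep_of_iSup_eq_top (fun m => ?_) ?_
  · refine Submodule.disjoint_def.2 fun w hw hw' => Subtype.ext ?_
    refine Submodule.disjoint_def.1 (hC.submodule_iSupIndep m) w hw ?_
    have := Submodule.mem_map_of_mem (f := W.subtype) hw'
    simp only [Submodule.map_iSup, hmap] at this
    exact SetLike.le_def.1 (iSup₂_mono fun _ _ => inf_le_left) this
  · refine (Submodule.map_injective_of_injective W.injective_subtype) (le_antisymm ?_ ?_)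
    · exact Submodule.map_mono le_top
    · simpa only [Submodule.map_iSup, hmap, Submodule.map_subtype_top] using hW

variable {n : ℕ} {C : ZMod n → Submodule F V} {x : Module.End F V} {φ : Module.Dual F V}

theorem invariantCore_le_iSup (hC : DirectSum.IsInternal C)
    (hx : ∀ m, ∀ v ∈ C m, x v ∈ C (m + 1)) {a : ZMod n} (hφ : ∀ m ≠ a, C m ≤ LinearMap.ker φ) :
    invariantCore φ x ≤ ⨆ m, C m ⊓ invariantCore φ x := by
  intro w hw
  obtain ⟨f, hf, rfl⟩ := (Submodule.mem_iSup_iff_exists_finsupp C w).1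
    (hC.submodule_iSup_eq_top ▸ Submodule.mem_top)
  have hφf {m : ZMod n} {j : ℕ} (h : m + j ≠ a) : φ ((x ^ j) (f m)) = 0 :=
    hφ _ h (pow_apply_mem hx (hf m) j)
  refine Submodule.sum_mem _ fun m hm => Submodule.mem_iSup_of_mem m ⟨hf m, ?_⟩
  refine mem_invariantCore.2 fun j => ?_
  by_cases h : m + j = a
  · rw [← mem_invariantCore.1 hw j, Finsupp.sum, map_sum, map_sum]
    refine (Finset.sum_eq_single_of_mem (f := fun m => φ ((x ^ j) (f m))) m hm fun m' _ hm' =>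
      hφf fun h' => hm' ?_).symm
    exact add_right_cancel (h'.trans h.symm)
  · exact hφf h

theorem exists_dual_ne_zero_of_mem (hC : DirectSum.IsInternal C) {a : ZMod n} {u : V}
    (hu : u ∈ C a) (h0 : u ≠ 0) :
    ∃ φ : Module.Dual F V, φ u ≠ 0 ∧ ∀ m ≠ a, C m ≤ LinearMap.ker φ := by
  obtain ⟨φ, hφ, hker⟩ := Submodule.exists_le_ker_of_notMem fun hu' =>
    h0 (Submodule.disjoint_def.1 (hC.submodule_iSupIndep a) u hu hu')
  exact ⟨φ, hφ, fun m hm => (le_iSup₂_of_le (f := fun m (_ : m ≠ a) => C m) m hm le_rfl).trans hker⟩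

theorem exists_mem_apply_ne_zero {ι : Type*} [DecidableEq ι] {C : ι → Submodule F V}
    (hC : DirectSum.IsInternal C) {T : Module.End F V} (hT : T ≠ 0) :
    ∃ m, ∃ v ∈ C m, T v ≠ 0 := by
  by_contra! h
  refine hT (LinearMap.ker_eq_top.1 (top_le_iff.1 ?_))
  rw [← hC.submodule_iSup_eq_top]
  exact iSup_le h

end Homogeneous

section Existence

variable {F : Type*} [Field F] {n : ℕ}

theorem IsColoredJordanBasis.len_le_of_pow_eq_zero {V : Type*} [AddCommGroup V] [Module F V]
    {C : ZMod n → Submodule F V} {x : Module.End F V} {c : ColoredPartition n}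
    {b : Module.Basis c.Box F V} (hb : IsColoredJordanBasis C x c b) {l : ℕ} (hx : x ^ l = 0)
    (i : ℕ) : c.len i ≤ l := by
  by_contra! h
  have hzero := hb.pow_apply_basisVector (le_refl (c.len i : ℤ)) l
  obtain ⟨k, hk⟩ := Nat.exists_eq_add_of_lt h
  rw [hx, LinearMap.zero_apply, show (c.len i : ℤ) - l = (k : ℤ) + 1 by omega,
    basisVector_add_one i k (by omega)] at hzero
  exact b.ne_zero _ hzero.symm

theorem isColoredJordanBasis_cons {V : Type*} [AddCommGroup V] [Module F V]
    {C : ZMod n → Submodule F V} {x : Module.End F V} (hx : ∀ m, ∀ v ∈ C m, x v ∈ C (m + 1))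
    {d : ℕ} (hd : x ^ (d + 1) = 0) {m : ZMod n} {v : V} (hv : v ∈ C m) {φ : Module.Dual F V}
    (hφ : φ ((x ^ d) v) ≠ 0) {c : ColoredPartition n}
    {b : Module.Basis c.Box F (invariantCore φ x)}
    (hb : IsColoredJordanBasis (fun m => (C m).comap (invariantCore φ x).subtype)
      (x.restrict fun _ => apply_mem_invariantCore) c b) (h : c.len 0 ≤ d + 1) :
    IsColoredJordanBasis C x (c.cons (d + 1) m h)
      ((stringBasis hd hφ b).reindex (c.consBoxEquiv (d + 1) m h).symm) := by
  set B := (stringBasis hd hφ b).reindex (c.consBoxEquiv (d + 1) m h).symm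
  have hB_zero (j : ℕ) (hj : j < d + 1) : B ⟨0, ⟨j, hj⟩⟩ = (x ^ (d - j)) v :=
    (Module.Basis.reindex_apply _ _ _).trans (stringBasis_inl hd hφ b ⟨j, hj⟩)
  have hB_succ (i j : ℕ) (hj : j < c.len i) : B ⟨i + 1, ⟨j, hj⟩⟩ = b ⟨i, ⟨j, hj⟩⟩ :=
    (Module.Basis.reindex_apply _ _ _).trans (stringBasis_inr hd hφ b ⟨i, ⟨j, hj⟩⟩)
  refine ⟨?_, ?_, ?_⟩
  · rintro ⟨_ | i, ⟨j, hj⟩⟩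
    · change j < d + 1 at hj
      rw [hB_zero j hj]
      convert pow_apply_mem hx hv (d - j) using 2
      change m + (((d + 1 : ℕ) - (j + 1 : ℤ) : ℤ) : ZMod n) = _
      rw [Nat.cast_sub (by omega)]
      push_cast
      ring
    · rw [hB_succ i j hj]
      exact hb.mem_color ⟨i, ⟨j, hj⟩⟩
  · rintro (_ | i) hi
    · rw [hB_zero 0 hi, ← Module.End.mul_apply, ← pow_succ', Nat.sub_zero, hd, LinearMap.zero_apply]
    · rw [hB_succ i 0 hi]
      exact congrArg Subtype.val (hb.apply_first i hi)
  · rintro (_ | i) j hj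
    · change j + 1 < d + 1 at hj
      rw [hB_zero (j + 1) hj, hB_zero j (by omega), ← Module.End.mul_apply, ← pow_succ']
      congr 2
      omega
    · change j + 1 < c.len i at hj
      rw [hB_succ i (j + 1) hj, hB_succ i j (by omega)]
      exact congrArg Subtype.val (hb.apply_succ i j hj)

theorem hasColoredJordanType_empty {V : Type*} [AddCommGroup V] [Module F V] [Subsingleton V]
    [NeZero n] (C : ZMod n → Submodule F V) (x : Module.End F V) :
    HasColoredJordanType C x (.empty n) := by
  have : IsEmpty (ColoredPartition.empty n).Box := ⟨fun p => p.2.elim0⟩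
  exact ⟨Module.Basis.empty V, isEmptyElim, fun _ h => absurd h (lt_irrefl 0),
    fun _ _ h => absurd h (Nat.not_lt_zero _)⟩

theorem exists_hasColoredJordanType [NeZero n] {V : Type*} [AddCommGroup V] [Module F V]
    [FiniteDimensional F V] {C : ZMod n → Submodule F V} {x : Module.End F V}
    (hC : DirectSum.IsInternal C) (hnil : IsNilpotent x)
    (hx : ∀ m, ∀ v ∈ C m, x v ∈ C (m + 1)) : ∃ c, HasColoredJordanType C x c := by
  induction hN : Module.finrank F V using Nat.strong_induction_on generalizing V with
  | _ N ih =>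
  rcases subsingleton_or_nontrivial V with hV | hV
  · exact ⟨_, hasColoredJordanType_empty C x⟩
  obtain ⟨d, hd, hne⟩ : ∃ d, x ^ (d + 1) = 0 ∧ x ^ d ≠ 0 :=
    ⟨nilpotencyClass x - 1, by
      rw [Nat.sub_add_cancel (pos_nilpotencyClass_iff.2 hnil), pow_nilpotencyClass hnil],
      pow_pred_nilpotencyClass hnil⟩
  obtain ⟨m, v, hv, hxv⟩ := exists_mem_apply_ne_zero hC hne
  obtain ⟨φ, hφ, hker⟩ := exists_dual_ne_zero_of_mem hC (pow_apply_mem hx hv d) hxv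
  have hlt : Module.finrank F (invariantCore φ x) < N := by
    refine hN ▸ Submodule.finrank_lt fun htop => hφ ?_
    exact mem_invariantCore.1 (htop ▸ Submodule.mem_top) d
  have hpow (k : ℕ) (hk : x ^ k = 0) :
      (x.restrict fun _ => apply_mem_invariantCore (φ := φ)) ^ k = 0 := by
    rw [Module.End.pow_restrict]
    exact LinearMap.ext fun w => Subtype.ext (by simp [hk])
  obtain ⟨c, b, hb⟩ := ih _ hlt
    (isInternal_comap_subtype hC (invariantCore_le_iSup hC hx hker))
    (hnil.imp hpow) (fun m w hw => hx m w hw) rfl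
  exact ⟨_, _, isColoredJordanBasis_cons hx hd hv hφ hb (hb.len_le_of_pow_eq_zero (hpow _ hd) 0)⟩

end Existence

/-! ### The markings `ρ_m(λ, ε, 0)` -/

namespace MarkedColoredPartition

variable {n : ℕ} [NeZero n] {m : ZMod n}

theorem isGreatest_rho_mark (m : ZMod n) (P : MarkedColoredPartition n) (i : ℕ) :
    IsGreatest (rhoCandidates m P i) ((P.rho m).mark i) :=
  have hbdd : BddAbove (rhoCandidates m P i) := ⟨P.mark i, fun _ hk => hk.1⟩
  ⟨Int.csSup_mem (rhoCandidates_nonempty m P i) hbdd, fun _ hk => le_csSup hbdd hk⟩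

theorem rho_mark_eq_iff {P : MarkedColoredPartition n} {i : ℕ} {k : ℤ} :
    (P.rho m).mark i = k ↔ P.mark i - n < k ∧ k ≤ P.mark i ∧ P.columnColor i k = m := by
  obtain ⟨⟨hle, hcolor⟩, hmax⟩ := isGreatest_rho_mark m P i
  have hlt : P.mark i - n < (P.rho m).mark i := by
    have hn : (0 : ℤ) < n := by exact_mod_cast NeZero.pos n
    have hcolor' : P.columnColor i ((P.rho m).mark i + n) = m := by
      rw [P.columnColor_add, Int.cast_natCast, ZMod.natCast_self, sub_zero]
      exact hcolor
    by_contra! h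
    have := hmax ⟨by omega, hcolor'⟩
    omega
  refine ⟨?_, fun ⟨hk, hk', hkm⟩ => (hmax ⟨hk', hkm⟩).antisymm' ?_⟩
  · rintro rfl
    exact ⟨hlt, hle, hcolor⟩
  · exact le_of_lt_add_of_intCast_eq (by linarith [hk, hle])
      ((P.columnColor_eq_columnColor_iff i _ _).1 (Eq.trans hcolor hkm.symm))

theorem rho_zeroMarking_mark_eq_iff {P : MarkedColoredPartition n} {c : ColoredPartition n}
    {i j : ℕ} (hlen : c.len i = P.len j) (hcolor : c.color i = P.color j) :
    (c.zeroMarking.rho m).mark i = P.mark j ↔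
      -(n : ℤ) < P.mark j ∧ P.mark j ≤ 0 ∧ P.markColor j = m := by
  have hcolumn : c.zeroMarking.columnColor i (P.mark j) = P.markColor j :=
    ColoredPartition.columnColor_congr hlen hcolor
  rw [rho_mark_eq_iff, hcolumn, ← zero_sub]
  rfl

theorem eq_rho_zeroMarking_iff {P : MarkedColoredPartition n} :
    P = P.toColoredPartition.zeroMarking.rho m ↔
      ∀ i, -(n : ℤ) < P.mark i ∧ P.mark i ≤ 0 ∧ P.markColor i = m := by
  refine ⟨fun h i => (rho_zeroMarking_mark_eq_iff rfl rfl).1 (h ▸ rfl), fun h => ?_⟩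
  exact MarkedColoredPartition.ext rfl rfl
    (funext fun i => ((rho_zeroMarking_mark_eq_iff rfl rfl).2 (h i)).symm)

theorem isColoredQuasiBipartition_and_mark_nonpos_iff {P : MarkedColoredPartition n} :
    (P.IsColoredQuasiBipartition ∧ ∀ i, P.mark i ≤ 0) ↔
      ∃ m, P = P.toColoredPartition.zeroMarking.rho m := by
  simp only [eq_rho_zeroMarking_iff]
  constructor
  · rintro ⟨⟨hn, -, hcolor⟩, h0⟩
    exact ⟨P.markColor 0, fun i => ⟨hn i, h0 i, hcolor i 0⟩⟩
  · rintro ⟨m, h⟩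
    refine ⟨⟨fun i => (h i).1, fun i j hij => ?_, fun i j => (h i).2.2.trans (h j).2.2.symm⟩,
      fun i => (h i).2.1⟩
    have hlen : P.len j ≤ P.len i := P.len_antitone hij.le
    have hi := h i
    have hj := h j
    simp only [nu]
    omega

theorem rowEquiv_rho_zeroMarking_iff {P : MarkedColoredPartition n} {c : ColoredPartition n} :
    P.RowEquiv (c.zeroMarking.rho m) ↔
      P.toColoredPartition.RowEquiv c ∧ P = P.toColoredPartition.zeroMarking.rho m := by
  rw [eq_rho_zeroMarking_iff]
  constructor
  · rintro ⟨σ, hσ⟩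
    refine ⟨⟨σ, fun i => ⟨(hσ i).1, (hσ i).2.1⟩⟩, σ.surjective.forall.2 fun i => ?_⟩
    exact (rho_zeroMarking_mark_eq_iff (hσ i).1 (hσ i).2.1).1 (hσ i).2.2
  · rintro ⟨⟨σ, hσ⟩, h⟩
    exact ⟨σ, fun i => ⟨(hσ i).1, (hσ i).2,
      (rho_zeroMarking_mark_eq_iff (hσ i).1 (hσ i).2).2 (h (σ i))⟩⟩

end MarkedColoredPartition

/-! ### The parameters of an orbit -/

section Parameters

variable {F : Type*} [Field F] {V : Type*} [AddCommGroup V] [Module F V] {n : ℕ}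
  {C : ZMod n → Submodule F V}

theorem exists_orbitOf_eq (O : Orbit C) : ∃ v x, orbitOf C v x = O := by
  obtain ⟨⟨v, x⟩, rfl⟩ := Quotient.exists_rep O
  exact ⟨v, x, rfl⟩

variable [FiniteDimensional F V] [NeZero n] {O : Orbit C} {v : V} {x : NilCone C}
  {P Q : MarkedColoredPartition n}

theorem hasNormalBasis_iff_exists_correspondsTo (hC : DirectSum.IsInternal C) :
    HasNormalBasis C v x ↔ ∃ P : MarkedColoredPartition n,
      P.IsGeneralizedQuasiBipartition ∧ CorrespondsTo C hC P (orbitOf C v x) := by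
  simp only [HasNormalBasis, correspondsTo_orbitOf_iff hC]
  exact ⟨fun ⟨P, b, hb, hv, hP⟩ => ⟨P, hP, b, hb, hv⟩,
    fun ⟨P, hP, b, hb, hv⟩ => ⟨P, b, hb, hv, hP⟩⟩

theorem exists_isGeneralizedQuasiBipartition_correspondsTo (hC : DirectSum.IsInternal C)
    (q : MarkedClass (spaceSignature C)) : ∃ P : MarkedColoredPartition n,
      P.IsGeneralizedQuasiBipartition ∧ CorrespondsTo C hC P (psiClass C hC q) := by
  obtain ⟨P, rfl⟩ := Quotient.exists_rep q
  obtain ⟨-, x, b, hb, -⟩ := exists_psi hC P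
  obtain ⟨μ, hμ, hgen, -, horbit⟩ := exists_isGeneralizedQuasiBipartition hC hb P.1.mark_le
  have hpsi : psiClass C hC ⟦P⟧ = orbitOf C (rowSum _ b μ) x := (psi_eq hC P hb).trans horbit.symm
  exact ⟨_, hgen, hpsi ▸ (correspondsTo_orbitOf_iff hC).2 ⟨b, hb, rfl⟩⟩

theorem range_psiClass (hC : DirectSum.IsInternal C) :
    Set.range (psiClass C hC) =
      {O | ∀ (v : V) (x : NilCone C), orbitOf C v x = O → HasNormalBasis C v x} := by
  ext O
  constructor
  · rintro ⟨q, rfl⟩ v x hvx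
    rw [hasNormalBasis_iff_exists_correspondsTo hC, hvx]
    exact exists_isGeneralizedQuasiBipartition_correspondsTo hC q
  · intro h
    obtain ⟨v, x, rfl⟩ := exists_orbitOf_eq O
    obtain ⟨P, -, hP, hO⟩ := (hasNormalBasis_iff_exists_correspondsTo hC).1 (h v x rfl)
    exact ⟨⟦⟨P, hP⟩⟧, hO⟩

theorem exists_isColoredQuasiBipartition_correspondsTo (hC : DirectSum.IsInternal C) {m : ZMod n}
    (hv : v ∈ C m) (x : NilCone C) : ∃ P : MarkedColoredPartition n,
      P.IsColoredQuasiBipartition ∧ CorrespondsTo C hC P (orbitOf C v x) := by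
  obtain ⟨c, b, hb⟩ := exists_hasColoredJordanType hC x.2.1 x.2.2
  obtain ⟨μ, hμ, hcolor, horbit⟩ := hb.exists_orbitOf_rowSum_eq hC hv
  obtain ⟨μ', hμ', hgen, hmod, horbit'⟩ := exists_isGeneralizedQuasiBipartition hC hb hμ
  have hmark : ∀ i, (c.withMark μ' hμ').markColor i = m := fun i =>
    ((c.columnColor_eq_columnColor_iff i _ _).2 (hmod i)).trans (hcolor i)
  have hmark' : ∀ i j, (c.withMark μ' hμ').markColor i = (c.withMark μ' hμ').markColor j :=
    fun i j => (hmark i).trans (hmark j).symm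
  refine ⟨_, ⟨hgen.1, fun i j hij => hgen.2 i j hij (hmark' i j), hmark'⟩, ?_⟩
  rw [← horbit, ← horbit', correspondsTo_orbitOf_iff]
  exact ⟨b, hb, rfl⟩

theorem mem_enhancedOrbits_iff (hC : DirectSum.IsInternal C) (O : Orbit C) :
    O ∈ enhancedOrbits C ↔
      ∃ P : MarkedColoredPartition n, P.IsColoredQuasiBipartition ∧ CorrespondsTo C hC P O := by
  constructor
  · rintro ⟨v, hv, x, rfl⟩
    obtain ⟨m, hm⟩ := Set.mem_iUnion.1 hv
    exact exists_isColoredQuasiBipartition_correspondsTo hC hm x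
  · rintro ⟨P, hP, h⟩
    obtain ⟨v, x, rfl⟩ := exists_orbitOf_eq O
    obtain ⟨b, hb, rfl⟩ := (correspondsTo_orbitOf_iff hC).1 h
    have hmem : markedVector P b ∈ C (P.markColor 0) := hb.rowSum_mem fun i _ => hP.2.2 i 0
    exact ⟨_, Set.mem_iUnion.2 ⟨_, hmem⟩, x, rfl⟩

theorem rowEquiv_of_correspondsTo (hC : DirectSum.IsInternal C) (hv : v ≠ 0)
    (hP : P.IsColoredQuasiBipartition) (hPO : CorrespondsTo C hC P (orbitOf C v x))
    (hQ : Q.IsColoredQuasiBipartition) (hQO : CorrespondsTo C hC Q (orbitOf C v x)) :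
    P.RowEquiv Q := by
  obtain ⟨b, hb, rfl⟩ := (correspondsTo_orbitOf_iff hC).1 hPO
  obtain ⟨d, hd, h⟩ := (correspondsTo_orbitOf_iff hC).1 hQO
  exact rowEquiv_of_markedVector_eq hC hb hd hP hQ h hv

theorem correspondsTo_orbitOf_zero_iff (hC : DirectSum.IsInternal C) :
    CorrespondsTo C hC P (orbitOf C 0 x) ↔
      HasColoredJordanType C x.1 P.toColoredPartition ∧ ∀ i, P.mark i ≤ 0 := by
  simp only [correspondsTo_orbitOf_iff hC, eq_comm (a := (0 : V)), markedVector_eq_zero_iff,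
    HasColoredJordanType, exists_and_right]

theorem weakEquiv_of_correspondsTo (hC : DirectSum.IsInternal C)
    (hP : P.IsColoredQuasiBipartition) (hPO : CorrespondsTo C hC P O)
    (hQ : Q.IsColoredQuasiBipartition) (hQO : CorrespondsTo C hC Q O) : P.WeakEquiv Q := by
  obtain ⟨v, x, rfl⟩ := exists_orbitOf_eq O
  by_cases hv : v = 0
  · subst hv
    obtain ⟨hPtype, hP0⟩ := (correspondsTo_orbitOf_zero_iff hC).1 hPO
    obtain ⟨hQtype, hQ0⟩ := (correspondsTo_orbitOf_zero_iff hC).1 hQO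
    obtain ⟨σ, hσ⟩ := hPtype.rowEquiv hC hQtype
    refine ⟨σ, fun i => ⟨(hσ i).1, (hσ i).2, fun h => ?_⟩⟩
    have := hP0 (σ i)
    have := hQ0 i
    omega
  · exact (rowEquiv_of_correspondsTo hC hv hP hPO hQ hQO).weakEquiv

theorem bijOn_psiClass (hC : DirectSum.IsInternal C) :
    Set.BijOn (psiClass C hC) (quasiBipartitionClasses (spaceSignature C)) (enhancedOrbits C) := by
  refine ⟨?_, ?_, fun O hO => ?_⟩
  · rintro _ ⟨P, hP, rfl⟩
    exact (mem_enhancedOrbits_iff hC _).2 ⟨P.1, hP, P.2, rfl⟩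
  · rintro _ ⟨P, hP, rfl⟩ _ ⟨Q, hQ, rfl⟩ h
    exact Quotient.sound (weakEquiv_of_correspondsTo hC hP ⟨P.2, rfl⟩ hQ ⟨Q.2, h.symm⟩)
  · obtain ⟨P, hP, hsig, rfl⟩ := (mem_enhancedOrbits_iff hC O).1 hO
    exact ⟨⟦⟨P, hsig⟩⟧, ⟨⟨P, hsig⟩, hP, rfl⟩, rfl⟩

theorem isColoredQuasiBipartition_and_correspondsTo_zero_iff (hC : DirectSum.IsInternal C) :
    (P.IsColoredQuasiBipartition ∧ CorrespondsTo C hC P (orbitOf C 0 x)) ↔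
      HasColoredJordanType C x.1 P.toColoredPartition ∧
        ∃ m, P = P.toColoredPartition.zeroMarking.rho m := by
  rw [correspondsTo_orbitOf_zero_iff, and_left_comm,
    MarkedColoredPartition.isColoredQuasiBipartition_and_mark_nonpos_iff]

theorem isColoredQuasiBipartition_and_correspondsTo_zero_iff_exists_eq
    (hC : DirectSum.IsInternal C) :
    (P.IsColoredQuasiBipartition ∧ CorrespondsTo C hC P (orbitOf C 0 x)) ↔
      ∃ (c : ColoredPartition n) (m : ZMod n),
        HasColoredJordanType C x.1 c ∧ P = c.zeroMarking.rho m := by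
  rw [isColoredQuasiBipartition_and_correspondsTo_zero_iff]
  constructor
  · rintro ⟨htype, m, hm⟩
    exact ⟨P.toColoredPartition, m, htype, hm⟩
  · rintro ⟨c, m, htype, rfl⟩
    exact ⟨htype, m, rfl⟩

theorem isColoredQuasiBipartition_and_correspondsTo_zero_iff_exists_rowEquiv
    (hC : DirectSum.IsInternal C) {c : ColoredPartition n} (hc : HasColoredJordanType C x.1 c) :
    (P.IsColoredQuasiBipartition ∧ CorrespondsTo C hC P (orbitOf C 0 x)) ↔
      ∃ m : ZMod n, P.RowEquiv (c.zeroMarking.rho m) := by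
  have htype : HasColoredJordanType C x.1 P.toColoredPartition ↔ P.toColoredPartition.RowEquiv c :=
    ⟨fun h => h.rowEquiv hC hc, fun h => hc.of_rowEquiv h.symm⟩
  simp only [isColoredQuasiBipartition_and_correspondsTo_zero_iff, htype,
    MarkedColoredPartition.rowEquiv_rho_zeroMarking_iff, exists_and_left]

end Parameters

end EnhancedCone

theorem mainTheorem1 {F : Type*} [Field F] {V : Type*} [AddCommGroup V] [Module F V]
    [FiniteDimensional F V] {n : ℕ} [NeZero n] (C : ZMod n → Submodule F V)
    (hC : DirectSum.IsInternal C) :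
    -- the image of `Ψ`
    (Set.range (psiClass C hC) =
        {O | ∀ (v : V) (x : NilCone C), orbitOf C v x = O → HasNormalBasis C v x}) ∧
    -- every nonempty fiber of `Ψ` contains a generalized quasi-bipartition
    (∀ q : MarkedClass (spaceSignature C), ∃ P : MarkedColoredPartition n,
        P.IsGeneralizedQuasiBipartition ∧ CorrespondsTo C hC P (psiClass C hC q)) ∧
    -- the bijection
    Set.BijOn (psiClass C hC) (quasiBipartitionClasses (spaceSignature C)) (enhancedOrbits C) ∧
    -- the orbits of colored pairs are those coming from colored quasi-bipartitions
    (∀ O : Orbit C, O ∈ enhancedOrbits C ↔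
        ∃ P : MarkedColoredPartition n, P.IsColoredQuasiBipartition ∧ CorrespondsTo C hC P O) ∧
    -- uniqueness of the parameter for `v ≠ 0`
    (∀ v ∈ coloredVectors C, v ≠ 0 → ∀ (x : NilCone C) (P Q : MarkedColoredPartition n),
        P.IsColoredQuasiBipartition → CorrespondsTo C hC P (orbitOf C v x) →
        Q.IsColoredQuasiBipartition → CorrespondsTo C hC Q (orbitOf C v x) → P.RowEquiv Q) ∧
    -- the parameters for `v = 0`
    (∀ (x : NilCone C) (P : MarkedColoredPartition n),
        (P.IsColoredQuasiBipartition ∧ CorrespondsTo C hC P (orbitOf C 0 x)) ↔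
          ∃ (c : ColoredPartition n) (m : ZMod n),
            HasColoredJordanType C x.1 c ∧ P = c.zeroMarking.rho m) ∧
    (∀ (x : NilCone C) (c : ColoredPartition n), HasColoredJordanType C x.1 c →
        ∀ P : MarkedColoredPartition n,
          (P.IsColoredQuasiBipartition ∧ CorrespondsTo C hC P (orbitOf C 0 x)) ↔
            ∃ m : ZMod n, P.RowEquiv (c.zeroMarking.rho m)) :=
  ⟨range_psiClass hC, exists_isGeneralizedQuasiBipartition_correspondsTo hC, bijOn_psiClass hC,
    mem_enhancedOrbits_iff hC,
    fun _ _ hv _ _ _ hP hPO hQ hQO => rowEquiv_of_correspondsTo hC hv hP hPO hQ hQO,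
    fun _ _ => isColoredQuasiBipartition_and_correspondsTo_zero_iff_exists_eq hC,
    fun _ _ hc _ => isColoredQuasiBipartition_and_correspondsTo_zero_iff_exists_rowEquiv hC hc⟩
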